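/- Let $(\overline M,J,\overline g)$ be a locally conformal Kähler manifold with Lee form $\omega$: $J$ is a smooth almost complex structure, $\overline g$ is a $J$-invariant Riemannian metric, and every point of $\overline M$ has an open neighbourhood $U$ with a smooth function $f_U$ on $U$ such that $e^{-f_U}\overline g|_U$ is Kähler and $\omega|_U=df_U$. Let $B$ be the Lee vector field, $\overline g(X,B)=\omega(X)$. Let $M$ be a (smoothly immersed) submanifold of $\overline M$ with induced metric $g$ and second fundamental form $h$ (the normal component of $\overline\nabla_XY$ for $X,Y$ tangent to $M$, where $\overline\nabla$ is the Levi-Civita connection of $\overline g$). Assume that $M$ is a CR-submanifold: there is a smooth distribution $D\subset TM$ with $JD=D$ whose orthogonal complement $D^\perp$ in $TM$ satisfies $JD^\perp\subset TM^\perp$. Assume that $M$ is anti-holomorphic, i.e. the orthogonal complement $\mu$ of $JD^\perp$ in the normal bundle $TM^\perp$ is $0$, and that $M$ is normal to the Lee field, i.e. $B$ is normal to $M$ at each point of $M$. Then $D^\perp$ is involutive, so that it is the tangent distribution of a foliation $\mathfrak F^\perp$ of $M$ (the canonical totally real foliation), and the induced metric $g$ is bundle-like for $\mathfrak F^\perp$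 if and only if $$h(U,JV)+h(V,JU)=0\qquad\text{for all } U,V\in\Gamma(D).$$ Here $g$ is called bundle-like for a foliation with tangent distribution $\mathcal D$ if the metric induced by $g$ on the transversal distribution $\mathcal D^\perp$ (the orthogonal complement of $\mathcal D$ in $TM$) is parallel with respect to the intrinsic connection $(X,N)\mapsto Q^\perp\nabla_{Q^\perp X}N+Q^\perp[QX,N]$ on $\mathcal D^\perp$, where $N\in\Gamma(\mathcal D^\perp)$, $\nabla$ is the Levi-Civita connection of $g$, and $Q$, $Q^\perp$ are the orthogonal projections of $TM$ to $\mathcal D$ and $\mathcal D^\perp$. -/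

import Mathlib

open Set Bundle VectorField
open scoped Manifold ContDiff Topology

/-! ### Linear algebra of a (positive definite) bilinear form on a tangent space -/

section LinearAlgebra

variable {T : Type*} [AddCommGroup T] [Module ℝ T] [TopologicalSpace T]
  [IsTopologicalAddGroup T] [ContinuousSMul ℝ T]

/-- The vector `φ♯` metrically equivalent to the covector `φ`: `b (sharp b φ) v = φ v`. -/
noncomputable def sharp (b : T →L[ℝ] T →L[ℝ] ℝ) (φ : T →L[ℝ] ℝ) : T :=
  ContinuousLinearMap.inverse b φ

/-- The pull-back `(x, y) ↦ b (a x) (a y)` of a bilinear form by a linear map. -/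
noncomputable def pullForm {T' : Type*} [AddCommGroup T'] [Module ℝ T'] [TopologicalSpace T']
    [IsTopologicalAddGroup T'] [ContinuousSMul ℝ T']
    (b : T →L[ℝ] T →L[ℝ] ℝ) (a : T' →L[ℝ] T) : T' →L[ℝ] T' →L[ℝ] ℝ :=
  (a.precomp ℝ).comp (b.comp a)

/-- The `b`-orthogonal projection of `x` to the subspace `W`: the vector of `W` which has
the same `b`-products with the elements of `W` as `x`. -/
noncomputable def orthProj (b : T →L[ℝ] T →L[ℝ] ℝ) (W : Submodule ℝ T) (x : T) : T :=
  (sharp (pullForm b W.subtypeL) ((b x).comp W.subtypeL) : W)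

/-- The `b`-orthogonal complement of a subspace. -/
def orthCompl (b : T →L[ℝ] T →L[ℝ] ℝ) (W : Submodule ℝ T) : Submodule ℝ T where
  carrier := {x | ∀ w ∈ W, b x w = 0}
  add_mem' := fun {x y} hx hy w hw => by
    simp [hx w hw, hy w hw]
  zero_mem' := fun w _ => by simp
  smul_mem' := fun c x hx w hw => by simp [hx w hw]

end LinearAlgebra

/-! ### Manifolds, vector fields, the Levi-Civita connection

A manifold `M` is modelled on a finite-dimensional real vector space `E`. Mathlib identifies
`T_pM` with `E` through the preferred chart at `p`. -/

section Connection

variable {E : Type*} [NormedAddCommGroup E] [NormedSpace ℝ E]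
  {M : Type*} [TopologicalSpace M] [ChartedSpace E M]

/-- A field of bilinear forms on the tangent spaces, such as a Riemannian metric. -/
abbrev FormField (E : Type*) [NormedAddCommGroup E] [NormedSpace ℝ E]
    (M : Type*) [TopologicalSpace M] [ChartedSpace E M] : Type _ :=
  (p : M) → TangentSpace 𝓘(ℝ, E) p →L[ℝ] TangentSpace 𝓘(ℝ, E) p →L[ℝ] ℝ

/-- A vector field on `M`. -/
abbrev VField (E : Type*) [NormedAddCommGroup E] [NormedSpace ℝ E]
    (M : Type*) [TopologicalSpace M] [ChartedSpace E M] : Type _ :=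
  (p : M) → TangentSpace 𝓘(ℝ, E) p

/-- The vector field `X` is smooth on `U`. -/
def SmoothFieldOn [IsManifold 𝓘(ℝ, E) ∞ M] (X : VField E M) (U : Set M) : Prop :=
  ContMDiffOn 𝓘(ℝ, E) (𝓘(ℝ, E).prod 𝓘(ℝ, E)) ∞
    (fun p ↦ (⟨p, X p⟩ : TangentBundle 𝓘(ℝ, E) M)) U

/-- The coefficients `x ↦ (g_ij(x))` of `g` in the preferred chart at `p`. -/
noncomputable def coordForm (g : FormField E M) (p : M) (x : E) : E →L[ℝ] E →L[ℝ] ℝ :=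
  let φ := extChartAt 𝓘(ℝ, E) p
  pullForm (T' := E) (g (φ.symm x)) (mfderiv 𝓘(ℝ, E) 𝓘(ℝ, E) φ.symm x)

set_option synthInstance.maxHeartbeats 200000 in
/-- The Christoffel symbols `Γ(u, v) = Γ^k_ij u^i v^j ∂_k` of `g` at `p` in the preferred chart
at `p`, given by `2 g(Γ(u,v), z) = ∂_u g(v,z) + ∂_v g(u,z) - ∂_z g(u,v)`. -/
noncomputable def christoffel (g : FormField E M) (p : M) (u v : E) : E :=
  let x₀ := extChartAt 𝓘(ℝ, E) p p
  let dg : E →L[ℝ] E →L[ℝ] E →L[ℝ] ℝ := fderiv ℝ (coordForm g p) x₀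
  sharp (coordForm g p x₀)
    ((1 / 2 : ℝ) • (dg u v + dg v u - (dg.flip u).flip v))

/-- The Levi-Civita connection of `g`: the vector `(∇_u Y)(p)`, for `u ∈ T_pM` and a vector
field `Y`, computed in the preferred chart at `p`. -/
noncomputable def covDeriv (g : FormField E M) (Y : VField E M) (p : M)
    (u : TangentSpace 𝓘(ℝ, E) p) : TangentSpace 𝓘(ℝ, E) p :=
  let φ := extChartAt 𝓘(ℝ, E) p
  let Yc : E → E := mpullback 𝓘(ℝ, E) 𝓘(ℝ, E) φ.symm Y
  (fderiv ℝ Yc (φ p) (u : E) + christoffel g p u (Yc (φ p)) : E)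

end Connection

/-! ### Distributions, foliations, bundle-like metrics -/

section Foliation

variable {E : Type*} [NormedAddCommGroup E] [NormedSpace ℝ E]
  {M : Type*} [TopologicalSpace M] [ChartedSpace E M] [IsManifold 𝓘(ℝ, E) ∞ M]

/-- A distribution on `M`: a choice of a subspace of every tangent space. -/
abbrev TangentDistribution (E : Type*) [NormedAddCommGroup E] [NormedSpace ℝ E]
    (M : Type*) [TopologicalSpace M] [ChartedSpace E M] : Type _ :=
  (p : M) → Submodule ℝ (TangentSpace 𝓘(ℝ, E) p)

/-- `X` is a section of the distribution `D` over `U`. -/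
def IsSectionOn (D : TangentDistribution E M) (X : VField E M) (U : Set M) : Prop :=
  SmoothFieldOn X U ∧ ∀ p ∈ U, X p ∈ D p

/-- A distribution is smooth (a vector subbundle of the tangent bundle) if it has a smooth
frame near every point. -/
def IsSmoothDistribution (D : TangentDistribution E M) : Prop :=
  ∀ p : M, ∃ U : Set M, IsOpen U ∧ p ∈ U ∧ ∃ (k : ℕ) (s : Fin k → VField E M),
    (∀ i, SmoothFieldOn (s i) U) ∧
    ∀ q ∈ U, LinearIndependent ℝ (fun i ↦ s i q) ∧
      Submodule.span ℝ (Set.range fun i ↦ s i q) = D q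

/-- A distribution is involutive if the bracket of two of its local sections is a section. -/
def IsInvolutive (D : TangentDistribution E M) : Prop :=
  ∀ (U : Set M) (X Y : VField E M), IsOpen U → IsSectionOn D X U → IsSectionOn D Y U →
    ∀ p ∈ U, mlieBracket 𝓘(ℝ, E) X Y p ∈ D p

/-- A foliation of `M`, given by its tangent distribution: a smooth involutive distribution. -/
structure Foliation (E : Type*) [NormedAddCommGroup E] [NormedSpace ℝ E]
    (M : Type*) [TopologicalSpace M] [ChartedSpace E M] [IsManifold 𝓘(ℝ, E) ∞ M] where
  tangent : TangentDistribution E M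
  smooth : IsSmoothDistribution tangent
  involutive : IsInvolutive tangent

/-- The transversal distribution of a foliation of `(M, g)`: the orthogonal complement of
its tangent distribution. -/
noncomputable def Foliation.transversal (𝓕 : Foliation E M) (g : FormField E M) : TangentDistribution E M :=
  fun p ↦ orthCompl (g p) (𝓕.tangent p)

/-- The projection `Q X` of a vector field to the tangent distribution of the foliation. -/
noncomputable def Foliation.tangentPart (𝓕 : Foliation E M) (g : FormField E M)
    (X : VField E M) : VField E M :=
  fun p ↦ orthProj (g p) (𝓕.tangent p) (X p)

/-- The projection `Q^⊥ X` of a vector field to the transversal distribution. -/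
noncomputable def Foliation.transversalPart (𝓕 : Foliation E M) (g : FormField E M)
    (X : VField E M) : VField E M :=
  fun p ↦ orthProj (g p) (𝓕.transversal g p) (X p)

/-- The intrinsic connection on the transversal distribution, for a section `N` of it:
`Q^⊥ (∇_{Q^⊥ X} N) + Q^⊥ [Q X, N]`. -/
noncomputable def Foliation.intrinsicConnection (𝓕 : Foliation E M) (g : FormField E M)
    (X N : VField E M) : VField E M :=
  𝓕.transversalPart g (fun p ↦ covDeriv g N p (𝓕.transversalPart g X p)
    + mlieBracket 𝓘(ℝ, E) (𝓕.tangentPart g X) N p)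

/-- The metric `g` is bundle-like for the foliation: the metric induced by `g` on the
transversal distribution is parallel with respect to the intrinsic connection, that is
`X (g(Y, Z)) = g(D_X Y, Z) + g(Y, D_X Z)` for all (local) vector fields `X` and all (local)
sections `Y`, `Z` of the transversal distribution. -/
def IsBundleLike (g : FormField E M) (𝓕 : Foliation E M) : Prop :=
  ∀ (U : Set M) (X Y Z : VField E M), IsOpen U → SmoothFieldOn X U →
    IsSectionOn (𝓕.transversal g) Y U → IsSectionOn (𝓕.transversal g) Z U → ∀ p ∈ U,
      (mfderiv 𝓘(ℝ, E) 𝓘(ℝ, ℝ) (fun q ↦ g q (Y q) (Z q)) p (X p) : ℝ) =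
        g p (𝓕.intrinsicConnection g X Y p) (Z p)
          + g p (Y p) (𝓕.intrinsicConnection g X Z p)

end Foliation

/-! ### Locally conformal Kähler manifolds -/

section LCK

variable {F : Type*} [NormedAddCommGroup F] [NormedSpace ℝ F]
  {N : Type*} [TopologicalSpace N] [ChartedSpace F N] [IsManifold 𝓘(ℝ, F) ∞ N]

/-- Smooth Riemannian metrics on `N`. -/
abbrev SmoothMetric (F : Type*) [NormedAddCommGroup F] [NormedSpace ℝ F]
    (N : Type*) [TopologicalSpace N] [ChartedSpace F N] [IsManifold 𝓘(ℝ, F) ∞ N] : Type _ :=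
  ContMDiffRiemannianMetric 𝓘(ℝ, F) ∞ F (fun q : N ↦ TangentSpace 𝓘(ℝ, F) q)

/-- A field of endomorphisms of the tangent spaces. -/
abbrev EndoField (F : Type*) [NormedAddCommGroup F] [NormedSpace ℝ F]
    (N : Type*) [TopologicalSpace N] [ChartedSpace F N] : Type _ :=
  (q : N) → TangentSpace 𝓘(ℝ, F) q →L[ℝ] TangentSpace 𝓘(ℝ, F) q

/-- `(N, J, g)` is almost Hermitian: `J` is a smooth almost complex structure and `g` is a
`J`-invariant Riemannian metric. -/
structure IsAlmostHermitian (g : SmoothMetric F N) (J : EndoField F N) : Prop where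
  smooth : ContMDiff 𝓘(ℝ, F) (𝓘(ℝ, F).prod 𝓘(ℝ, F →L[ℝ] F)) ∞
    (fun q ↦ (⟨q, J q⟩ : TotalSpace (F →L[ℝ] F)
      (fun q : N ↦ TangentSpace 𝓘(ℝ, F) q →L[ℝ] TangentSpace 𝓘(ℝ, F) q)))
  sq : ∀ (q : N) (v : TangentSpace 𝓘(ℝ, F) q), J q (J q v) = -v
  isometry : ∀ (q : N) (v w : TangentSpace 𝓘(ℝ, F) q),
    g.inner q (J q v) (J q w) = g.inner q v w

/-- The almost Hermitian metric `g` is Kähler on the open set `U`: `J` is parallel on `U` for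
the Levi-Civita connection, `∇_u (J Y) = J ∇_u Y`. -/
def IsKahlerOn (g : FormField F N) (J : EndoField F N) (U : Set N) : Prop :=
  ∀ (V : Set N) (Y : VField F N), IsOpen V → V ⊆ U → SmoothFieldOn Y V →
    ∀ q ∈ V, ∀ u : TangentSpace 𝓘(ℝ, F) q,
      covDeriv g (fun r ↦ J r (Y r)) q u = J q (covDeriv g Y q u)

/-- `(N, J, g)` is locally conformal Kähler with Lee form `η`: every point has an open
neighbourhood `U` and a smooth function `f` on `U` such that the metric `exp (-f) g` is Kähler
on `U` and `η = df` on `U`. -/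
def IsLCKWithLeeForm (g : SmoothMetric F N) (J : EndoField F N)
    (η : (q : N) → TangentSpace 𝓘(ℝ, F) q →L[ℝ] ℝ) : Prop :=
  IsAlmostHermitian g J ∧
  ∀ p : N, ∃ (U : Set N) (f : N → ℝ), IsOpen U ∧ p ∈ U ∧
    ContMDiffOn 𝓘(ℝ, F) 𝓘(ℝ, ℝ) ∞ f U ∧
    IsKahlerOn (fun q ↦ Real.exp (-f q) • g.inner q) J U ∧
    ∀ q ∈ U, ∀ v : TangentSpace 𝓘(ℝ, F) q, η q v = (mfderiv 𝓘(ℝ, F) 𝓘(ℝ, ℝ) f q v : ℝ)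

/-- The Lee vector field `B = η♯`. -/
noncomputable def leeField (g : SmoothMetric F N)
    (η : (q : N) → TangentSpace 𝓘(ℝ, F) q →L[ℝ] ℝ) : VField F N :=
  fun q ↦ sharp (g.inner q) (η q)

end LCK

/-! ### Submanifolds -/

section Submanifold

variable {E : Type*} [NormedAddCommGroup E] [NormedSpace ℝ E]
  {M : Type*} [TopologicalSpace M] [ChartedSpace E M]
  {F : Type*} [NormedAddCommGroup F] [NormedSpace ℝ F]
  {N : Type*} [TopologicalSpace N] [ChartedSpace F N] [IsManifold 𝓘(ℝ, F) ∞ N]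

/-- The differential of `i : M → N` at `p`. -/
noncomputable abbrev diffAt (E F : Type*) [NormedAddCommGroup E] [NormedSpace ℝ E]
    [NormedAddCommGroup F] [NormedSpace ℝ F]
    {M : Type*} [TopologicalSpace M] [ChartedSpace E M]
    {N : Type*} [TopologicalSpace N] [ChartedSpace F N] (i : M → N) (p : M) :
    TangentSpace 𝓘(ℝ, E) p →L[ℝ] TangentSpace 𝓘(ℝ, F) (i p) :=
  mfderiv 𝓘(ℝ, E) 𝓘(ℝ, F) i p

/-- `i` makes `M` a submanifold of `N`: it is a smooth immersion. -/
def IsSubmanifold (E F : Type*) [NormedAddCommGroup E] [NormedSpace ℝ E]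
    [NormedAddCommGroup F] [NormedSpace ℝ F]
    {M : Type*} [TopologicalSpace M] [ChartedSpace E M]
    {N : Type*} [TopologicalSpace N] [ChartedSpace F N] (i : M → N) : Prop :=
  ContMDiff 𝓘(ℝ, E) 𝓘(ℝ, F) ∞ i ∧ ∀ p, Function.Injective (diffAt E F i p)

/-- The metric induced on `M`. -/
noncomputable def inducedMetric (g : SmoothMetric F N) (i : M → N) : FormField E M :=
  fun p ↦ pullForm (g.inner (i p)) (diffAt E F i p)

/-- The tangent space of `M` at `p` as a subspace of the tangent space of `N`. -/
noncomputable def tangentImage (E F : Type*) [NormedAddCommGroup E] [NormedSpace ℝ E]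
    [NormedAddCommGroup F] [NormedSpace ℝ F]
    {M : Type*} [TopologicalSpace M] [ChartedSpace E M]
    {N : Type*} [TopologicalSpace N] [ChartedSpace F N] (i : M → N) (p : M) :
    Submodule ℝ (TangentSpace 𝓘(ℝ, F) (i p)) :=
  LinearMap.range (diffAt E F i p).toLinearMap

/-- The normal space of `M` at `p`. -/
noncomputable def normalSpace (E : Type*) [NormedAddCommGroup E] [NormedSpace ℝ E]
    {M : Type*} [TopologicalSpace M] [ChartedSpace E M]
    (g : SmoothMetric F N) (i : M → N) (p : M) : Submodule ℝ (TangentSpace 𝓘(ℝ, F) (i p)) :=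
  orthCompl (g.inner (i p)) (tangentImage E F i p)

/-- The second fundamental form `h(u, v)` at `p`, the normal component of `∇_u V` in `N` for any
vector field `V` tangent to `M` which extends `v`. In the preferred charts at `p` and `i p`, where
`i` reads `ic`, it is the normal component of `D²ic(u, v) + Γ(Dic u, Dic v)`. -/
noncomputable def secondFundamentalForm (g : SmoothMetric F N) (i : M → N) (p : M)
    (u v : TangentSpace 𝓘(ℝ, E) p) : TangentSpace 𝓘(ℝ, F) (i p) :=
  let ic : E → F := writtenInExtChartAt 𝓘(ℝ, E) 𝓘(ℝ, F) p i
  let d2 : E →L[ℝ] E →L[ℝ] F := fderiv ℝ (fderiv ℝ ic) (extChartAt 𝓘(ℝ, E) p p)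
  let a : TangentSpace 𝓘(ℝ, F) (i p) :=
    (d2 u v + christoffel (fun q ↦ g.inner q) (i p) (diffAt E F i p u) (diffAt E F i p v) : F)
  orthProj (g.inner (i p)) (normalSpace E g i p) a

/-- The orthogonal complement `D^⊥` in the tangent bundle of `M` of a distribution `D`. -/
noncomputable def perpDistribution (g : SmoothMetric F N) (i : M → N) (D : TangentDistribution E M) :
    TangentDistribution E M :=
  fun p ↦ orthCompl (inducedMetric g i p) (D p)

/-- The subspace `J D_p` of the tangent space of `N`, for a distribution `D` on `M`. -/
noncomputable def JImage (J : EndoField F N) (i : M → N) (D : TangentDistribution E M) (p : M) :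
    Submodule ℝ (TangentSpace 𝓘(ℝ, F) (i p)) :=
  ((D p).map (diffAt E F i p).toLinearMap).map (J (i p)).toLinearMap

/-- `M` is a CR-submanifold of `(N, J, g)` with holomorphic distribution `D`: `D` is a smooth
distribution with `J D = D` and `J D^⊥` is normal to `M`. -/
structure IsCRSubmanifold [IsManifold 𝓘(ℝ, E) ∞ M] (g : SmoothMetric F N) (J : EndoField F N)
    (i : M → N) (D : TangentDistribution E M) : Prop where
  submanifold : IsSubmanifold E F i
  smooth : IsSmoothDistribution D
  holomorphic : ∀ p, JImage J i D p = (D p).map (diffAt E F i p).toLinearMap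
  totallyReal : ∀ p, JImage J i (perpDistribution g i D) p ≤ normalSpace E g i p

/-- The subspace `μ_p`: the orthogonal complement of `J D^⊥_p` in the normal space. -/
noncomputable def muSpace (g : SmoothMetric F N) (J : EndoField F N) (i : M → N)
    (D : TangentDistribution E M) (p : M) : Submodule ℝ (TangentSpace 𝓘(ℝ, F) (i p)) :=
  normalSpace E g i p ⊓ orthCompl (g.inner (i p)) (JImage J i (perpDistribution g i D) p)

/-- A CR-submanifold is anti-holomorphic (generic) if `μ = 0`. -/
def IsAntiHolomorphic (g : SmoothMetric F N) (J : EndoField F N) (i : M → N)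
    (D : TangentDistribution E M) : Prop :=
  ∀ p, muSpace g J i D p = ⊥

end Submanifold

/-!
The proof rests on one differential identity, and the rest is reading it off in two cases.

The conformal change formula for the Christoffel symbols turns the parallelism of `J` for the local
Kähler metrics `exp (-f) g` into a formula for `∇J` in terms of the Lee field `B` alone
(`IsMetricAt.fderiv_of_parallel`, `IsLCKWithLeeForm.isLCKAt`):
`(∇_W J) V = ½ (g(B, J V) W - g(W, J V) B - g(B, V) J W + g(W, V) J B)`.
If `Y` is a section of `D^⊥`, then `J Y` is normal to `M`, so `g(J Y, V) = 0` for `V` tangent to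
`M`. Differentiating this along `M` and inserting `∇J` expresses `g(J ∇_Z Y, V)` by `g(J Y, h(Z, V))`
and terms in `B` (`IsLCKAt.covDeriv_totallyReal`).

*Involutivity.* For `Y`, `Z` in `D^⊥` and `V` in `D`, three instances of the identity combine,
by the symmetry of the second fundamental form, to `g([Y, Z], V) = 0`, with no hypothesis on `B`
(`IsLCKAt.bracket_totallyReal`).

*Bundle-like metrics.* Since `∇` is metric and torsion-free, the defect of parallelism of the metric
for the intrinsic connection is `g(∇_Y T, Z) + g(∇_Z T, Y)`, with `T` the component of the
differentiating field along the leaves (`Foliation.intrinsicConnection_parallel_iff`). The identity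
for `T`, together with `B` being normal, rewrites this as `-g(J T, h(Y, J Z) + h(Z, J Y))`
(`IsLCKAt.symm_covDeriv_totallyReal`). It vanishes for all `T` in `D^⊥` if and only if
`h(Y, J Z) + h(Z, J Y) = 0`, because `J D^⊥` exhausts the normal bundle when `μ = 0`.

The Levi-Civita connection and `h` at `p` are defined in the preferred charts at `p` and `i p`, so
these identities are proved on vector spaces, for an arbitrary smooth map `c` into a space with a
metric `G`, and then applied to the representatives of the data in those charts. Separately, `D^⊥`
has to be shown to be a smooth distribution; this follows from the formula for orthogonal
projections in terms of the inverse Gram matrix (`IsSmoothDistribution.orthCompl`).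
-/

set_option linter.unusedSectionVars false
set_option synthInstance.maxHeartbeats 200000

/-! ### Linear algebra of inner products -/

section InnerProductAlgebra

variable {T : Type*} [AddCommGroup T] [Module ℝ T] [TopologicalSpace T]
  [IsTopologicalAddGroup T] [ContinuousSMul ℝ T]

/-- A bilinear form which is symmetric and positive definite. -/
structure IsInnerForm (b : T →L[ℝ] T →L[ℝ] ℝ) : Prop where
  symm : ∀ x y, b x y = b y x
  pos : ∀ x, x ≠ 0 → 0 < b x x

namespace IsInnerForm

variable {b : T →L[ℝ] T →L[ℝ] ℝ}

lemma eq_zero_of_self (hb : IsInnerForm b) {x : T} (h : b x x = 0) : x = 0 := by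
  by_contra hx
  exact (hb.pos x hx).ne' h

lemma eq_of_forall (hb : IsInnerForm b) {x y : T} (h : ∀ z, b x z = b y z) : x = y := by
  have : b (x - y) (x - y) = 0 := by simp [h]
  exact sub_eq_zero.1 (hb.eq_zero_of_self this)

lemma pullForm {T' : Type*} [AddCommGroup T'] [Module ℝ T'] [TopologicalSpace T']
    [IsTopologicalAddGroup T'] [ContinuousSMul ℝ T'] (hb : IsInnerForm b) (a : T' →L[ℝ] T)
    (ha : Function.Injective a) : IsInnerForm (pullForm b a) where
  symm x y := hb.symm (a x) (a y)
  pos x hx := hb.pos (a x) fun h ↦ hx (ha (h.trans (map_zero a).symm))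

variable [FiniteDimensional ℝ T] [T2Space T]

/-- An inner product on a finite-dimensional space identifies it with its dual, so that `sharp` has
the value its name promises. -/
lemma sharp_apply (hb : IsInnerForm b) (φ : T →L[ℝ] ℝ) (v : T) : b (sharp b φ) v = φ v := by
  have hinj : Function.Injective b := fun x y h ↦ hb.eq_of_forall fun z ↦ by rw [h]
  let e₀ : (T →L[ℝ] ℝ) ≃ₗ[ℝ] (T →ₗ[ℝ] ℝ) := LinearMap.toContinuousLinearMap.symm
  have : FiniteDimensional ℝ (T →L[ℝ] ℝ) := e₀.symm.finiteDimensional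
  have hd : Module.finrank ℝ T = Module.finrank ℝ (T →L[ℝ] ℝ) := by
    rw [e₀.finrank_eq]; exact (Subspace.dual_finrank_eq (K := ℝ) (V := T)).symm
  let e := (LinearMap.linearEquivOfInjective b.toLinearMap hinj hd).toContinuousLinearEquiv
  have he : (e : T →L[ℝ] T →L[ℝ] ℝ) = b := by ext x; rfl
  have : sharp b φ = e.symm φ := by
    rw [sharp, ← he, ContinuousLinearMap.inverse_equiv]; rfl
  rw [this]
  conv_lhs => rw [← he]
  simp

lemma orthProj_mem (W : Submodule ℝ T) (x : T) : orthProj b W x ∈ W := Subtype.coe_prop _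

lemma restrict (hb : IsInnerForm b) (W : Submodule ℝ T) :
    IsInnerForm (_root_.pullForm b W.subtypeL) :=
  hb.pullForm _ W.injective_subtype

lemma orthProj_apply (hb : IsInnerForm b) (W : Submodule ℝ T) (x : T) {w : T} (hw : w ∈ W) :
    b (orthProj b W x) w = b x w :=
  (hb.restrict W).sharp_apply ((b x).comp W.subtypeL) ⟨w, hw⟩

lemma eq_orthProj (hb : IsInnerForm b) {W : Submodule ℝ T} {x y : T} (hy : y ∈ W)
    (h : ∀ w ∈ W, b y w = b x w) : orthProj b W x = y := by
  have hm : orthProj b W x - y ∈ W := W.sub_mem (orthProj_mem W x) hy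
  have : b (orthProj b W x - y) (orthProj b W x - y) = 0 := by
    rw [map_sub b, sub_apply, hb.orthProj_apply W x hm, h _ hm, sub_self]
  exact sub_eq_zero.1 (hb.eq_zero_of_self this)

lemma orthProj_of_mem (hb : IsInnerForm b) {W : Submodule ℝ T} {x : T} (hx : x ∈ W) :
    orthProj b W x = x :=
  hb.eq_orthProj hx fun _ _ ↦ rfl

lemma orthProj_add (hb : IsInnerForm b) (W : Submodule ℝ T) (x y : T) :
    orthProj b W (x + y) = orthProj b W x + orthProj b W y :=
  hb.eq_orthProj (W.add_mem (orthProj_mem W x) (orthProj_mem W y)) fun w hw ↦ by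
    simp [hb.orthProj_apply W _ hw]

lemma sub_orthProj_mem (hb : IsInnerForm b) (W : Submodule ℝ T) (x : T) :
    x - orthProj b W x ∈ orthCompl b W := fun w hw ↦ by
  simp [hb.orthProj_apply W x hw]

lemma orthCompl_orthCompl (hb : IsInnerForm b) (W : Submodule ℝ T) :
    orthCompl b (orthCompl b W) = W := by
  refine le_antisymm (fun x hx ↦ ?_) fun x hx w hw ↦ (hb.symm _ _).trans (hw x hx)
  have h1 := hb.sub_orthProj_mem W x
  have h2 : b (x - orthProj b W x) (x - orthProj b W x) = 0 := by
    rw [map_sub b x, sub_apply, hx _ h1, hb.symm, h1 _ (orthProj_mem W x),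
      sub_zero]
  rw [sub_eq_zero.1 (hb.eq_zero_of_self h2)]
  exact orthProj_mem W x

lemma orthProj_orthCompl (hb : IsInnerForm b) (W : Submodule ℝ T) (x : T) :
    orthProj b (orthCompl b W) x = x - orthProj b W x :=
  hb.eq_orthProj (hb.sub_orthProj_mem W x) fun w hw ↦ by
    rw [map_sub, sub_apply, hb.symm (orthProj b W x),
      hw _ (orthProj_mem W x), sub_zero]

lemma isCompl_orthCompl (hb : IsInnerForm b) (W : Submodule ℝ T) :
    IsCompl W (orthCompl b W) := by
  refine ⟨disjoint_iff.2 ?_, codisjoint_iff.2 ?_⟩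
  · refine (Submodule.eq_bot_iff _).2 fun x hx ↦ hb.eq_zero_of_self (hx.2 x hx.1)
  · refine (Submodule.eq_top_iff').2 fun x ↦ ?_
    rw [← add_sub_cancel (orthProj b W x) x]
    exact Submodule.add_mem_sup (orthProj_mem W x) (hb.sub_orthProj_mem W x)

lemma finrank_add_finrank_orthCompl (hb : IsInnerForm b) (W : Submodule ℝ T) :
    Module.finrank ℝ W + Module.finrank ℝ (orthCompl b W) = Module.finrank ℝ T :=
  Submodule.finrank_add_eq_of_isCompl (hb.isCompl_orthCompl W)

end IsInnerForm

end InnerProductAlgebra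

/-! ### Christoffel symbols of a metric on a vector space -/

section Flat

variable {E : Type*} [NormedAddCommGroup E] [NormedSpace ℝ E]
  {F : Type*} [NormedAddCommGroup F] [NormedSpace ℝ F]

/-- The Christoffel symbols at `x₀` of a field `G` of bilinear forms on a vector space. -/
noncomputable def flatChristoffel (G : E → E →L[ℝ] E →L[ℝ] ℝ) (x₀ u v : E) : E :=
  sharp (G x₀) ((1 / 2 : ℝ) •
    (fderiv ℝ G x₀ u v + fderiv ℝ G x₀ v u - ((fderiv ℝ G x₀).flip u).flip v))

/-- `G` is differentiable and positive definite at `x₀` and symmetric near `x₀`: what it takes for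
the Christoffel symbols at `x₀` to have their usual properties. -/
structure IsMetricAt (G : E → E →L[ℝ] E →L[ℝ] ℝ) (x₀ : E) : Prop where
  diff : DifferentiableAt ℝ G x₀
  symm : ∀ᶠ x in 𝓝 x₀, ∀ u v, G x u v = G x v u
  inner : IsInnerForm (G x₀)

/-- The covariant derivative at `x₀` in the direction `w` of a field `ξ` along the map `c`, for
the Levi-Civita connection of the metric `G` on the target of `c`. -/
noncomputable def covDerivAlong (G : F → F →L[ℝ] F →L[ℝ] ℝ) (c : E → F) (ξ : E → F)
    (x₀ w : E) : F :=
  fderiv ℝ ξ x₀ w + flatChristoffel G (c x₀) (fderiv ℝ c x₀ w) (ξ x₀)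

/-- The covariant derivative along `c` of the image under `Dc` of the constant field `v`; the
normal component of this symmetric bilinear expression is the second fundamental form. -/
noncomputable def hessianAlong (G : F → F →L[ℝ] F →L[ℝ] ℝ) (c : E → F) (x₀ u v : E) : F :=
  fderiv ℝ (fderiv ℝ c) x₀ u v +
    flatChristoffel G (c x₀) (fderiv ℝ c x₀ u) (fderiv ℝ c x₀ v)

/-- The covariant derivative along `c` of the image of a field under `Dc`. -/
lemma covDerivAlong_fderiv_apply (G : F → F →L[ℝ] F →L[ℝ] ℝ) {c : E → F} {x₀ : E}
    (hc : ContDiffAt ℝ ∞ c x₀) {Y : E → E} (hY : DifferentiableAt ℝ Y x₀) (w : E) :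
    covDerivAlong G c (fun x ↦ fderiv ℝ c x (Y x)) x₀ w =
      fderiv ℝ c x₀ (fderiv ℝ Y x₀ w) + hessianAlong G c x₀ w (Y x₀) := by
  have hd : DifferentiableAt ℝ (fderiv ℝ c) x₀ :=
    (hc.fderiv_right (m := 1) (by norm_num; exact ENat.LEInfty.out)).differentiableAt (by simp)
  have h := congr($((hd.hasFDerivAt.clm_apply hY.hasFDerivAt).fderiv) w)
  rw [covDerivAlong, h, hessianAlong]
  simp [add_assoc]

namespace IsMetricAt

lemma fderiv_symm {G : F → F →L[ℝ] F →L[ℝ] ℝ} {y₀ : F} (hG : IsMetricAt G y₀) (w u v : F) :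
    fderiv ℝ G y₀ w u v = fderiv ℝ G y₀ w v u := by
  have h1 := ((hG.diff.hasFDerivAt.clm_apply (hasFDerivAt_const u y₀)).clm_apply
    (hasFDerivAt_const v y₀))
  have h2 := ((hG.diff.hasFDerivAt.clm_apply (hasFDerivAt_const v y₀)).clm_apply
    (hasFDerivAt_const u y₀))
  have h3 := h1.congr_of_eventuallyEq (hG.symm.mono fun x hx ↦ hx v u)
  have := congr($(h3.unique h2) w)
  simpa using this

variable [FiniteDimensional ℝ F] {G : F → F →L[ℝ] F →L[ℝ] ℝ} {y₀ : F}

lemma flatChristoffel_apply (hG : IsMetricAt G y₀) (u v z : F) :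
    G y₀ (flatChristoffel G y₀ u v) z =
      1 / 2 * (fderiv ℝ G y₀ u v z + fderiv ℝ G y₀ v u z - fderiv ℝ G y₀ z u v) := by
  rw [flatChristoffel, hG.inner.sharp_apply]
  simp

lemma flatChristoffel_comm (hG : IsMetricAt G y₀) (u v : F) :
    flatChristoffel G y₀ u v = flatChristoffel G y₀ v u :=
  hG.inner.eq_of_forall fun z ↦ by
    rw [hG.flatChristoffel_apply, hG.flatChristoffel_apply, hG.fderiv_symm z u v]
    ring

/-- The Levi-Civita connection is metric. -/
lemma fderiv_apply (hG : IsMetricAt G y₀) (w u v : F) :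
    fderiv ℝ G y₀ w u v =
      G y₀ (flatChristoffel G y₀ w u) v + G y₀ u (flatChristoffel G y₀ w v) := by
  rw [hG.inner.symm u, hG.flatChristoffel_apply, hG.flatChristoffel_apply,
    hG.fderiv_symm w v u]
  ring

/-- The covariant derivative along a map is metric. -/
lemma hasFDerivAt_along {c : E → F} {x₀ : E} (hG : IsMetricAt G (c x₀)) {ξ ζ : E → F}
    (hc : DifferentiableAt ℝ c x₀) (hξ : DifferentiableAt ℝ ξ x₀)
    (hζ : DifferentiableAt ℝ ζ x₀) :
    DifferentiableAt ℝ (fun x ↦ G (c x) (ξ x) (ζ x)) x₀ ∧ ∀ w,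
    fderiv ℝ (fun x ↦ G (c x) (ξ x) (ζ x)) x₀ w =
      G (c x₀) (covDerivAlong G c ξ x₀ w) (ζ x₀) + G (c x₀) (ξ x₀) (covDerivAlong G c ζ x₀ w) := by
  have h₀ : HasFDerivAt (fun x ↦ G (c x)) ((fderiv ℝ G (c x₀)).comp (fderiv ℝ c x₀)) x₀ :=
    HasFDerivAt.comp (g := G) x₀ hG.diff.hasFDerivAt hc.hasFDerivAt
  have h := (h₀.clm_apply hξ.hasFDerivAt).clm_apply hζ.hasFDerivAt
  refine ⟨h.differentiableAt, fun w ↦ ?_⟩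
  have h' := congr($(h.fderiv) w)
  rw [h']
  simp only [covDerivAlong, map_add, add_apply, ContinuousLinearMap.comp_apply,
    ContinuousLinearMap.flip_apply, hG.fderiv_apply]
  ring

lemma hessianAlong_comm {c : E → F} {x₀ : E} (hG : IsMetricAt G (c x₀))
    (hc : ContDiffAt ℝ ∞ c x₀) (u v : E) : hessianAlong G c x₀ u v = hessianAlong G c x₀ v u := by
  have : IsSymmSndFDerivAt ℝ c x₀ := hc.isSymmSndFDerivAt (by simpa using ENat.LEInfty.out)
  rw [hessianAlong, hessianAlong, this.eq, hG.flatChristoffel_comm]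

/-- The Gauss formula: the Christoffel symbols of the induced metric are the tangential part of
the second derivative of the immersion. -/
lemma induced_flatChristoffel [FiniteDimensional ℝ E] {c : E → F} {x₀ : E}
    (hG : IsMetricAt G (c x₀)) (hc : ContDiffAt ℝ ∞ c x₀) {H : E → E →L[ℝ] E →L[ℝ] ℝ}
    (hH : IsMetricAt H x₀)
    (h : ∀ᶠ x in 𝓝 x₀, ∀ u v, H x u v = G (c x) (fderiv ℝ c x u) (fderiv ℝ c x v))
    (u v z : E) :
    H x₀ (flatChristoffel H x₀ u v) z =
      G (c x₀) (hessianAlong G c x₀ u v) (fderiv ℝ c x₀ z) := by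
  have hd : DifferentiableAt ℝ (fderiv ℝ c) x₀ :=
    (hc.fderiv_right (m := 1) (by norm_num; exact ENat.LEInfty.out)).differentiableAt (by simp)
  -- the first derivatives of `H`; the Koszul formula then leaves only one of the Hessian terms
  have key (w u v : E) : fderiv ℝ H x₀ w u v =
      G (c x₀) (hessianAlong G c x₀ w u) (fderiv ℝ c x₀ v) +
        G (c x₀) (fderiv ℝ c x₀ u) (hessianAlong G c x₀ w v) := by
    have h1 := (hG.hasFDerivAt_along (hc.differentiableAt (by simp))
      (hd.clm_apply (differentiableAt_const u)) (hd.clm_apply (differentiableAt_const v))).2 w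
    rw [covDerivAlong_fderiv_apply G hc (differentiableAt_const u),
      covDerivAlong_fderiv_apply G hc (differentiableAt_const v)] at h1
    have h2 := ((hH.diff.hasFDerivAt.clm_apply (hasFDerivAt_const u x₀)).clm_apply
      (hasFDerivAt_const v x₀)).congr_of_eventuallyEq (h.mono fun x hx ↦ (hx u v).symm)
    rw [h2.fderiv] at h1
    simpa using h1
  rw [hH.flatChristoffel_apply, key, key, key, hG.hessianAlong_comm hc z u,
    hG.hessianAlong_comm hc z v, hG.hessianAlong_comm hc v u,
    hG.inner.symm _ (hessianAlong G c x₀ u z), hG.inner.symm _ (hessianAlong G c x₀ v z)]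
  ring

end IsMetricAt

/-! ### Conformal change of the metric and the derivative of the complex structure -/

/-- The product rule, at a generality at which it applies to fields of bilinear forms without
comparing the two scalar actions on their space. -/
lemma hasFDerivAt_smul_field {V : Type*} [NormedAddCommGroup V] [NormedSpace ℝ V] {G : F → V}
    {y₀ : F} {f : F → ℝ} {f' : F →L[ℝ] ℝ} (hf : HasFDerivAt f f' y₀)
    (hG : DifferentiableAt ℝ G y₀) :
    HasFDerivAt (fun y ↦ f y • G y) (f y₀ • fderiv ℝ G y₀ + f'.smulRight (G y₀)) y₀ :=
  hf.fun_smul hG.hasFDerivAt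

variable [FiniteDimensional ℝ F] {G : F → F →L[ℝ] F →L[ℝ] ℝ} {y₀ : F}

lemma IsMetricAt.exp_smul (hG : IsMetricAt G y₀) {f : F → ℝ} (hf : DifferentiableAt ℝ f y₀)
    {G' : F → F →L[ℝ] F →L[ℝ] ℝ} (h : ∀ᶠ y in 𝓝 y₀, G' y = Real.exp (-f y) • G y) :
    IsMetricAt G' y₀ where
  diff := by
    have he : DifferentiableAt ℝ (fun y ↦ Real.exp (-f y)) y₀ := hf.neg.exp
    exact (hasFDerivAt_smul_field (G := G) he.hasFDerivAt
      hG.diff).differentiableAt.congr_of_eventuallyEq h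
  symm := by
    filter_upwards [h, hG.symm] with y hy hs u v
    simp [hy, hs u v]
  inner := by
    rw [h.self_of_nhds]
    exact ⟨fun u v ↦ by simp [hG.inner.symm u v],
      fun u hu ↦ mul_pos (Real.exp_pos _) (hG.inner.pos u hu)⟩

/-- The change of the Christoffel symbols under a conformal change of the metric. -/
lemma IsMetricAt.flatChristoffel_exp_smul (hG : IsMetricAt G y₀) {f : F → ℝ}
    (hf : DifferentiableAt ℝ f y₀) {G' : F → F →L[ℝ] F →L[ℝ] ℝ}
    (h : ∀ᶠ y in 𝓝 y₀, G' y = Real.exp (-f y) • G y) (u v : F) :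
    flatChristoffel G' y₀ u v = flatChristoffel G y₀ u v -
      (1 / 2 : ℝ) • (fderiv ℝ f y₀ u • v + fderiv ℝ f y₀ v • u
        - G y₀ u v • sharp (G y₀) (fderiv ℝ f y₀)) := by
  have hG' := hG.exp_smul hf h
  have hd (w u v : F) : fderiv ℝ G' y₀ w u v =
      Real.exp (-f y₀) * (fderiv ℝ G y₀ w u v - fderiv ℝ f y₀ w * G y₀ u v) := by
    have he : HasFDerivAt (fun y ↦ Real.exp (-f y)) (Real.exp (-f y₀) • -fderiv ℝ f y₀) y₀ :=
      hf.hasFDerivAt.neg.exp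
    have h1 := (hasFDerivAt_smul_field (G := G) he hG.diff).congr_of_eventuallyEq h
    rw [h1.fderiv]
    simp
    ring
  refine hG'.inner.eq_of_forall fun z ↦ ?_
  rw [hG'.flatChristoffel_apply, hd, hd, hd, h.self_of_nhds]
  simp only [map_sub, map_add, map_smul, smul_apply, sub_apply, add_apply, smul_eq_mul,
    hG.flatChristoffel_apply, hG.inner.sharp_apply]
  ring

/-- If `J` is parallel for the conformal metric `exp (-f) G`, the covariant derivative of `J` for
the metric `G` is the algebraic expression in `df` and its metric dual on the right. -/
lemma IsMetricAt.fderiv_of_parallel (hG : IsMetricAt G y₀) {f : F → ℝ}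
    (hf : DifferentiableAt ℝ f y₀) {G' : F → F →L[ℝ] F →L[ℝ] ℝ}
    (h : ∀ᶠ y in 𝓝 y₀, G' y = Real.exp (-f y) • G y) {J : F → F →L[ℝ] F}
    (hJ : ∀ w y, fderiv ℝ J y₀ w y + flatChristoffel G' y₀ w (J y₀ y) =
      J y₀ (flatChristoffel G' y₀ w y)) (w y : F) :
    fderiv ℝ J y₀ w y + flatChristoffel G y₀ w (J y₀ y) = J y₀ (flatChristoffel G y₀ w y) +
      (1 / 2 : ℝ) • (fderiv ℝ f y₀ (J y₀ y) • w - G y₀ w (J y₀ y) • sharp (G y₀) (fderiv ℝ f y₀)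
        - fderiv ℝ f y₀ y • J y₀ w + G y₀ w y • J y₀ (sharp (G y₀) (fderiv ℝ f y₀))) := by
  have := hJ w y
  rw [hG.flatChristoffel_exp_smul hf h, hG.flatChristoffel_exp_smul hf h] at this
  simp only [map_sub, map_add, map_smul] at this
  rw [add_sub, sub_eq_iff_eq_add] at this
  rw [this]
  module

end Flat

/-! ### Totally real fields along an immersion into a locally conformal Kähler space -/

section Flat

variable {E : Type*} [NormedAddCommGroup E] [NormedSpace ℝ E]
  {F : Type*} [NormedAddCommGroup F] [NormedSpace ℝ F]

/-- The first-order data at `y₀` of a locally conformal Kähler structure `(G, J)` on a vector space,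
with Lee vector `B`. The field `covDeriv` is the formula
`(∇_w J) y = ½ (G(B, J y) w - G(w, J y) B - G(B, y) J w + G(w, y) J B)`, with `∇` written out. -/
structure IsLCKAt (G : F → F →L[ℝ] F →L[ℝ] ℝ) (J : F → F →L[ℝ] F) (y₀ B : F) : Prop where
  metric : IsMetricAt G y₀
  diff : DifferentiableAt ℝ J y₀
  sq : ∀ v, J y₀ (J y₀ v) = -v
  isometry : ∀ u v, G y₀ (J y₀ u) (J y₀ v) = G y₀ u v
  covDeriv : ∀ w y, fderiv ℝ J y₀ w y + flatChristoffel G y₀ w (J y₀ y) =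
    J y₀ (flatChristoffel G y₀ w y) + (1 / 2 : ℝ) • (G y₀ B (J y₀ y) • w - G y₀ w (J y₀ y) • B
      - G y₀ B y • J y₀ w + G y₀ w y • J y₀ B)

/-- Near `x₀`, the field `J (Dc Y)` along `c` is normal to the image of `Dc`. -/
structure IsTotallyRealAt (G : F → F →L[ℝ] F →L[ℝ] ℝ) (J : F → F →L[ℝ] F) (c : E → F) (x₀ : E)
    (Y : E → E) : Prop where
  diff : DifferentiableAt ℝ Y x₀
  normal : ∀ᶠ x in 𝓝 x₀, ∀ v, G (c x) (J (c x) (fderiv ℝ c x (Y x))) (fderiv ℝ c x v) = 0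

namespace IsLCKAt

variable [FiniteDimensional ℝ F] {G : F → F →L[ℝ] F →L[ℝ] ℝ} {J : F → F →L[ℝ] F}
  {c : E → F} {x₀ : E} {B : F}

lemma skew {y₀ : F} (h : IsLCKAt G J y₀ B) (u v : F) :
    G y₀ (J y₀ u) v = -G y₀ u (J y₀ v) := by
  have := h.isometry u (J y₀ v)
  rw [h.sq, map_neg] at this
  rw [← this, neg_neg]

/-- Differentiating `G (J (Dc Y)) (Dc v) = 0` gives the `J`-image of the covariant derivative of a
totally real field `Y` in terms of the second derivative of `c` and the Lee vector. -/
lemma covDeriv_totallyReal (h : IsLCKAt G J (c x₀) B) (hc : ContDiffAt ℝ ∞ c x₀) {Y : E → E}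
    (hY : IsTotallyRealAt G J c x₀ Y) (z v : E) :
    G (c x₀) (J (c x₀) (fderiv ℝ c x₀ (fderiv ℝ Y x₀ z) + hessianAlong G c x₀ z (Y x₀)))
        (fderiv ℝ c x₀ v) =
      -G (c x₀) (J (c x₀) (fderiv ℝ c x₀ (Y x₀))) (hessianAlong G c x₀ z v) - 1 / 2 *
        (G (c x₀) B (J (c x₀) (fderiv ℝ c x₀ (Y x₀))) * G (c x₀) (fderiv ℝ c x₀ z) (fderiv ℝ c x₀ v)
        - G (c x₀) B (fderiv ℝ c x₀ (Y x₀)) *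
          G (c x₀) (J (c x₀) (fderiv ℝ c x₀ z)) (fderiv ℝ c x₀ v)
        + G (c x₀) (fderiv ℝ c x₀ z) (fderiv ℝ c x₀ (Y x₀)) *
          G (c x₀) (J (c x₀) B) (fderiv ℝ c x₀ v)) := by
  have hd : DifferentiableAt ℝ (fderiv ℝ c) x₀ :=
    (hc.fderiv_right (m := 1) (by norm_num; exact ENat.LEInfty.out)).differentiableAt (by simp)
  have hc' : DifferentiableAt ℝ c x₀ := hc.differentiableAt (by simp)
  have hξ : DifferentiableAt ℝ (fun x ↦ fderiv ℝ c x (Y x)) x₀ := hd.clm_apply hY.diff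
  have hJ₀ : HasFDerivAt (fun x ↦ J (c x)) ((fderiv ℝ J (c x₀)).comp (fderiv ℝ c x₀)) x₀ :=
    HasFDerivAt.comp (g := J) x₀ h.diff.hasFDerivAt hc'.hasFDerivAt
  have hJξ := hJ₀.clm_apply hξ.hasFDerivAt
  have e1 := (h.metric.hasFDerivAt_along hc' hJξ.differentiableAt
    (hd.clm_apply (differentiableAt_const v))).2 z
  have e0 :
      fderiv ℝ (fun x ↦ G (c x) (J (c x) (fderiv ℝ c x (Y x))) (fderiv ℝ c x v)) x₀ z = 0 := by
    have := Filter.EventuallyEq.fderiv_eq (𝕜 := ℝ)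
      (f₁ := fun x ↦ G (c x) (J (c x) (fderiv ℝ c x (Y x))) (fderiv ℝ c x v)) (f := fun _ ↦ (0 : ℝ))
      (hY.normal.mono fun x hx ↦ hx v)
    rw [this]; simp
  rw [e0, covDerivAlong_fderiv_apply G hc (differentiableAt_const v)] at e1
  -- the covariant derivative of `J Y` is `J` of that of `Y` plus the Lee terms
  have e2 : covDerivAlong G c (fun x ↦ J (c x) (fderiv ℝ c x (Y x))) x₀ z =
      J (c x₀) (covDerivAlong G c (fun x ↦ fderiv ℝ c x (Y x)) x₀ z) +
        (1 / 2 : ℝ) • (G (c x₀) B (J (c x₀) (fderiv ℝ c x₀ (Y x₀))) • fderiv ℝ c x₀ z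
          - G (c x₀) (fderiv ℝ c x₀ z) (J (c x₀) (fderiv ℝ c x₀ (Y x₀))) • B
          - G (c x₀) B (fderiv ℝ c x₀ (Y x₀)) • J (c x₀) (fderiv ℝ c x₀ z)
          + G (c x₀) (fderiv ℝ c x₀ z) (fderiv ℝ c x₀ (Y x₀)) • J (c x₀) B) := by
    rw [covDerivAlong, covDerivAlong, map_add, add_assoc, ← h.covDeriv, hJξ.fderiv]
    simp only [add_apply, ContinuousLinearMap.comp_apply, ContinuousLinearMap.flip_apply]
    abel
  have hn : G (c x₀) (fderiv ℝ c x₀ z) (J (c x₀) (fderiv ℝ c x₀ (Y x₀))) = 0 := by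
    rw [h.metric.inner.symm]; exact hY.normal.self_of_nhds z
  rw [e2, covDerivAlong_fderiv_apply G hc hY.diff, hn] at e1
  simp only [fderiv_fun_const, Pi.zero_apply, zero_apply, map_zero, zero_add,
    zero_smul, map_add, map_sub, map_smul, add_apply, sub_apply, smul_apply, smul_eq_mul,
    sub_zero] at e1 ⊢
  linarith

/-- The bracket of two totally real fields is orthogonal to every holomorphic direction orthogonal
to both. The derivatives `∇_Y Z`, `∇_Z Y` tested on `J v' = v` leave the terms `G (J Z, h(Y, v'))`
and `G (J Y, h(Z, v'))`, which are equal by the identity for `∇_{v'} Y` tested on `Z`. -/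
lemma bracket_totallyReal (h : IsLCKAt G J (c x₀) B) (hc : ContDiffAt ℝ ∞ c x₀) {Y Z : E → E}
    (hY : IsTotallyRealAt G J c x₀ Y) (hZ : IsTotallyRealAt G J c x₀ Z) {v v' : E}
    (hv : J (c x₀) (fderiv ℝ c x₀ v') = fderiv ℝ c x₀ v)
    (hvY : G (c x₀) (fderiv ℝ c x₀ v) (fderiv ℝ c x₀ (Y x₀)) = 0)
    (hvZ : G (c x₀) (fderiv ℝ c x₀ v) (fderiv ℝ c x₀ (Z x₀)) = 0)
    (hvY' : G (c x₀) (fderiv ℝ c x₀ v') (fderiv ℝ c x₀ (Y x₀)) = 0)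
    (hvZ' : G (c x₀) (fderiv ℝ c x₀ v') (fderiv ℝ c x₀ (Z x₀)) = 0) :
    G (c x₀) (fderiv ℝ c x₀ (fderiv ℝ Z x₀ (Y x₀) - fderiv ℝ Y x₀ (Z x₀)))
      (fderiv ℝ c x₀ v) = 0 := by
  have s := h.metric.inner.symm
  have a1 := h.covDeriv_totallyReal hc hZ (Y x₀) v'
  have a2 := h.covDeriv_totallyReal hc hY (Z x₀) v'
  have a3 := h.covDeriv_totallyReal hc hY v' (Z x₀)
  rw [s (fderiv ℝ c x₀ (Y x₀)) (fderiv ℝ c x₀ v'), hvY', h.skew (fderiv ℝ c x₀ (Y x₀)), hv,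
    s (fderiv ℝ c x₀ (Y x₀)) (fderiv ℝ c x₀ v), hvY, h.skew, hv] at a1
  rw [s (fderiv ℝ c x₀ (Z x₀)) (fderiv ℝ c x₀ v'), hvZ', h.skew (fderiv ℝ c x₀ (Z x₀)), hv,
    s (fderiv ℝ c x₀ (Z x₀)) (fderiv ℝ c x₀ v), hvZ, h.skew, hv,
    s (fderiv ℝ c x₀ (Z x₀)), h.metric.hessianAlong_comm hc (Z x₀) (Y x₀)] at a2
  have hn := hZ.normal.self_of_nhds (fderiv ℝ Y x₀ v')
  rw [hvZ', hvY', hv, hvZ, h.skew, map_add, add_apply, s _ (J (c x₀) _), hn,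
    s _ (J (c x₀) _)] at a3
  rw [h.metric.hessianAlong_comm hc v' (Z x₀), h.metric.hessianAlong_comm hc v' (Y x₀)] at a3
  simp only [map_add, add_apply, map_sub, sub_apply] at a1 a2 a3 ⊢
  linarith

/-- The failure of a totally real field `T` to be a Killing field in the holomorphic directions
`u`, `v` is measured by the component along `J T` of the second fundamental form. -/
lemma symm_covDeriv_totallyReal (h : IsLCKAt G J (c x₀) B) (hc : ContDiffAt ℝ ∞ c x₀) {T : E → E}
    (hT : IsTotallyRealAt G J c x₀ T) (hB : ∀ v, G (c x₀) B (fderiv ℝ c x₀ v) = 0)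
    {u v Ju Jv : E} (hu : fderiv ℝ c x₀ Ju = J (c x₀) (fderiv ℝ c x₀ u))
    (hv : fderiv ℝ c x₀ Jv = J (c x₀) (fderiv ℝ c x₀ v))
    (huT : G (c x₀) (fderiv ℝ c x₀ u) (fderiv ℝ c x₀ (T x₀)) = 0)
    (hvT : G (c x₀) (fderiv ℝ c x₀ v) (fderiv ℝ c x₀ (T x₀)) = 0) :
    G (c x₀) (fderiv ℝ c x₀ (fderiv ℝ T x₀ u) + hessianAlong G c x₀ u (T x₀)) (fderiv ℝ c x₀ v) +
      G (c x₀) (fderiv ℝ c x₀ (fderiv ℝ T x₀ v) + hessianAlong G c x₀ v (T x₀)) (fderiv ℝ c x₀ u) =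
    -G (c x₀) (J (c x₀) (fderiv ℝ c x₀ (T x₀)))
      (hessianAlong G c x₀ u Jv + hessianAlong G c x₀ v Ju) := by
  have a1 := h.covDeriv_totallyReal hc hT u Jv
  have a2 := h.covDeriv_totallyReal hc hT v Ju
  rw [hv, h.isometry, huT, hB] at a1
  rw [hu, h.isometry, hvT, hB] at a2
  -- the remaining Lee terms are skew in `u` and `v`
  have a3 : G (c x₀) (fderiv ℝ c x₀ u) (J (c x₀) (fderiv ℝ c x₀ v)) =
      -G (c x₀) (fderiv ℝ c x₀ v) (J (c x₀) (fderiv ℝ c x₀ u)) := by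
    rw [h.metric.inner.symm, h.skew]
  rw [a1, a2, a3, map_add]
  ring

end IsLCKAt

end Flat

/-! ### Vector fields, forms and endomorphisms in the preferred chart -/

section Chart

variable {E : Type*} [NormedAddCommGroup E] [NormedSpace ℝ E]
  {M : Type*} [TopologicalSpace M] [ChartedSpace E M]

/-- The differential at `x` of the inverse of the preferred chart at `p`. -/
noncomputable def chartDiff (E : Type*) [NormedAddCommGroup E] [NormedSpace ℝ E]
    {M : Type*} [TopologicalSpace M] [ChartedSpace E M] (p : M) (x : E) :
    E →L[ℝ] TangentSpace 𝓘(ℝ, E) ((extChartAt 𝓘(ℝ, E) p).symm x) :=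
  mfderiv 𝓘(ℝ, E) 𝓘(ℝ, E) (extChartAt 𝓘(ℝ, E) p).symm x

/-- The vector field `Y` in the preferred chart at `p`. Outside the target of the chart, where
`chartDiff` may fail to be invertible, the value is junk. -/
noncomputable def coordField (p : M) (Y : VField E M) (x : E) : E :=
  (chartDiff E p x).inverse (Y ((extChartAt 𝓘(ℝ, E) p).symm x))

lemma covDeriv_eq (g : FormField E M) (Y : VField E M) (p : M) (u : TangentSpace 𝓘(ℝ, E) p) :
    covDeriv g Y p u = (fderiv ℝ (coordField p Y) (extChartAt 𝓘(ℝ, E) p p) u +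
      flatChristoffel (coordForm g p) (extChartAt 𝓘(ℝ, E) p p) u
        (coordField p Y (extChartAt 𝓘(ℝ, E) p p)) : E) := rfl

lemma coordForm_apply (g : FormField E M) (p : M) (x u v : E) :
    coordForm g p x u v =
      g ((extChartAt 𝓘(ℝ, E) p).symm x) (chartDiff E p x u) (chartDiff E p x v) := rfl

variable [IsManifold 𝓘(ℝ, E) ∞ M]

/-- The endomorphism field `J` in the preferred chart at `p`, with junk values off its target. -/
noncomputable def coordEndo (J : EndoField E M) (p : M) (x : E) : E →L[ℝ] E :=
  (chartDiff E p x).inverse.comp ((J ((extChartAt 𝓘(ℝ, E) p).symm x)).comp (chartDiff E p x))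

instance : IsManifold 𝓘(ℝ, E) 1 M := IsManifold.of_le (n := ∞) ENat.LEInfty.out

variable {p : M}

lemma chartDiff_isInvertible {x : E} (hx : x ∈ (extChartAt 𝓘(ℝ, E) p).target) :
    (chartDiff E p x).IsInvertible := by
  have := isInvertible_mfderivWithin_extChartAt_symm (I := 𝓘(ℝ, E)) hx
  rw [ModelWithCorners.range_eq_univ, mfderivWithin_univ] at this
  exact this

lemma chartDiff_self : chartDiff E p (extChartAt 𝓘(ℝ, E) p p) = ContinuousLinearMap.id ℝ E := by
  have := mfderivWithin_range_extChartAt_symm (I := 𝓘(ℝ, E)) (x := p)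
  rw [ModelWithCorners.range_eq_univ, mfderivWithin_univ] at this
  exact this

lemma chartDiff_inverse {x : E} (hx : x ∈ (extChartAt 𝓘(ℝ, E) p).target)
    (v : TangentSpace 𝓘(ℝ, E) ((extChartAt 𝓘(ℝ, E) p).symm x)) :
    chartDiff E p x ((chartDiff E p x).inverse v) = v := by
  obtain ⟨e, he⟩ := chartDiff_isInvertible hx
  rw [← he, ContinuousLinearMap.inverse_equiv]
  exact e.apply_symm_apply v

lemma inverse_chartDiff {x : E} (hx : x ∈ (extChartAt 𝓘(ℝ, E) p).target) (v : E) :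
    (chartDiff E p x).inverse (chartDiff E p x v) = v := by
  obtain ⟨e, he⟩ := chartDiff_isInvertible hx
  rw [← he, ContinuousLinearMap.inverse_equiv]
  exact e.symm_apply_apply v

lemma eventually_mem_target :
    ∀ᶠ x in 𝓝 (extChartAt 𝓘(ℝ, E) p p), x ∈ (extChartAt 𝓘(ℝ, E) p).target :=
  extChartAt_target_mem_nhds p

lemma chartDiff_coordField (Y : VField E M) {x : E} (hx : x ∈ (extChartAt 𝓘(ℝ, E) p).target) :
    chartDiff E p x (coordField p Y x) = Y ((extChartAt 𝓘(ℝ, E) p).symm x) :=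
  chartDiff_inverse hx _

lemma coordField_self (Y : VField E M) : coordField p Y (extChartAt 𝓘(ℝ, E) p p) = Y p := by
  have := chartDiff_coordField Y (mem_extChartAt_target (I := 𝓘(ℝ, E)) p)
  rw [chartDiff_self, extChartAt_to_inv] at this
  exact this

lemma contDiffAt_coordField [CompleteSpace E] {Y : VField E M} {U : Set M} (hU : IsOpen U)
    (hp : p ∈ U) (hY : SmoothFieldOn Y U) :
    ContDiffAt ℝ ∞ (coordField p Y) (extChartAt 𝓘(ℝ, E) p p) := by
  have h1 : ContMDiffWithinAt 𝓘(ℝ, E) (𝓘(ℝ, E).prod 𝓘(ℝ, E)) ∞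
    (fun p ↦ (⟨p, Y p⟩ : TangentBundle 𝓘(ℝ, E) M)) univ p :=
    ((hY p hp).contMDiffAt (hU.mem_nhds hp)).contMDiffWithinAt
  have h2 := contMDiffWithinAt_mpullbackWithin_extChartAt_symm (n := ∞) h1 uniqueMDiffOn_univ
    (mem_univ _) (by simp)
  rw [ModelWithCorners.range_eq_univ, mpullbackWithin_univ, preimage_univ, inter_univ] at h2
  exact contMDiffAt_vectorSpace_iff_contDiffAt.1 (h2.contMDiffAt (extChartAt_target_mem_nhds p))

/-- The Lie bracket at `p`, in the preferred chart at `p`: the differential of the chart at `p` is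
the identity. -/
lemma mlieBracket_eq (X Y : VField E M) :
    mlieBracket 𝓘(ℝ, E) X Y p =
      (fderiv ℝ (coordField p Y) (extChartAt 𝓘(ℝ, E) p p) (X p) -
        fderiv ℝ (coordField p X) (extChartAt 𝓘(ℝ, E) p p) (Y p) : E) := by
  have h0 : (mfderiv 𝓘(ℝ, E) 𝓘(ℝ, E) (extChartAt 𝓘(ℝ, E) p) p : E →L[ℝ] E) =
    ContinuousLinearMap.id ℝ E := mfderiv_extChartAt_self
  have h1 (Z : VField E M) : mpullbackWithin 𝓘(ℝ, E) 𝓘(ℝ, E) (extChartAt 𝓘(ℝ, E) p).symm Z univ =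
      coordField p Z := by
    rw [mpullbackWithin_univ]; rfl
  rw [← mlieBracketWithin_univ, mlieBracketWithin_apply, ModelWithCorners.range_eq_univ,
    preimage_univ, inter_univ, h1, h1]
  refine (congrArg (fun L : E →L[ℝ] E ↦ L.inverse (lieBracketWithin ℝ (coordField p X)
    (coordField p Y) univ (extChartAt 𝓘(ℝ, E) p p))) h0).trans ?_
  rw [lieBracketWithin_univ, lieBracket, coordField_self, coordField_self]
  simp

lemma mfderiv_eq_fderiv_chart {f : M → ℝ} (hf : MDifferentiableAt 𝓘(ℝ, E) 𝓘(ℝ, ℝ) f p) (u : E) :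
    (mfderiv 𝓘(ℝ, E) 𝓘(ℝ, ℝ) f p u : ℝ) =
      fderiv ℝ (fun x ↦ f ((extChartAt 𝓘(ℝ, E) p).symm x)) (extChartAt 𝓘(ℝ, E) p p) u := by
  rw [hf.mfderiv, ModelWithCorners.range_eq_univ, fderivWithin_univ]
  rfl

/-- The vector field which is constant, with value `u`, in the preferred chart at `p`. It is defined
by the trivialization of the tangent bundle, which makes its smoothness immediate. -/
noncomputable def constField (p : M) (u : E) : VField E M := fun q ↦
  (trivializationAt E (TangentSpace 𝓘(ℝ, E)) p).symmL ℝ q u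

lemma constField_smooth (u : E) : SmoothFieldOn (constField p u) (extChartAt 𝓘(ℝ, E) p).source := by
  intro q hq
  set t := trivializationAt E (TangentSpace 𝓘(ℝ, E)) p
  have hs : (extChartAt 𝓘(ℝ, E) p).source = t.baseSet := by
    rw [extChartAt_source, TangentBundle.trivializationAt_baseSet]
  rw [hs] at hq ⊢
  refine (t.contMDiffWithinAt_section _ hq).2 ?_
  have h : ContMDiffOn 𝓘(ℝ, E) 𝓘(ℝ, E) ∞ (fun _ : M ↦ u) t.baseSet := contMDiffOn_const
  exact h.congr (fun x hx ↦ by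
    change (t ⟨x, t.symmL ℝ x u⟩).2 = u
    rw [t.symmL_apply hx, t.apply_mk_symm hx]) q hq

lemma constField_symm (u : E) {x : E} (hx : x ∈ (extChartAt 𝓘(ℝ, E) p).target) :
    constField p u ((extChartAt 𝓘(ℝ, E) p).symm x) = chartDiff E p x u := by
  have hs : (extChartAt 𝓘(ℝ, E) p).symm x ∈ (chartAt E p).source := by
    rw [← extChartAt_source 𝓘(ℝ, E)]; exact (extChartAt 𝓘(ℝ, E) p).map_target hx
  rw [constField, TangentBundle.symmL_trivializationAt (I := 𝓘(ℝ, E)) hs,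
    (extChartAt 𝓘(ℝ, E) p).right_inv hx]
  simp [chartDiff]

lemma constField_self (u : E) : constField p u p = u := by
  have := constField_symm u (mem_extChartAt_target (I := 𝓘(ℝ, E)) p)
  rw [chartDiff_self, extChartAt_to_inv] at this
  exact this

end Chart

/-! ### Smooth metrics and induced metrics in the preferred charts -/

section SmoothForm

variable {E : Type*} [NormedAddCommGroup E] [NormedSpace ℝ E]
  {M : Type*} [TopologicalSpace M] [ChartedSpace E M] [IsManifold 𝓘(ℝ, E) ∞ M]
  {F : Type*} [NormedAddCommGroup F] [NormedSpace ℝ F]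
  {N : Type*} [TopologicalSpace N] [ChartedSpace F N] [IsManifold 𝓘(ℝ, F) ∞ N]

/-- A Riemannian metric given as a field of forms, with smoothness tested on pairs of smooth vector
fields. -/
structure IsSmoothMetricForm (g : FormField E M) : Prop where
  inner : ∀ p, IsInnerForm (g p)
  smooth : ∀ (U : Set M) (X Y : VField E M), IsOpen U → SmoothFieldOn X U → SmoothFieldOn Y U →
    ContMDiffOn 𝓘(ℝ, E) 𝓘(ℝ, ℝ) ∞ (fun q ↦ g q (X q) (Y q)) U

lemma SmoothMetric.contMDiffOn_inner (g : SmoothMetric F N) {b : M → N} {U : Set M}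
    {v w : ∀ m, TangentSpace 𝓘(ℝ, F) (b m)}
    (hb : ContMDiffOn 𝓘(ℝ, E) 𝓘(ℝ, F) ∞ b U)
    (hv : ContMDiffOn 𝓘(ℝ, E) (𝓘(ℝ, F).prod 𝓘(ℝ, F)) ∞
      (fun m ↦ (⟨b m, v m⟩ : TangentBundle 𝓘(ℝ, F) N)) U)
    (hw : ContMDiffOn 𝓘(ℝ, E) (𝓘(ℝ, F).prod 𝓘(ℝ, F)) ∞
      (fun m ↦ (⟨b m, w m⟩ : TangentBundle 𝓘(ℝ, F) N)) U) :
    ContMDiffOn 𝓘(ℝ, E) 𝓘(ℝ, ℝ) ∞ (fun m ↦ g.inner (b m) (v m) (w m)) U := by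
  intro x hx
  have : ContMDiffWithinAt 𝓘(ℝ, E) (𝓘(ℝ, F).prod 𝓘(ℝ, ℝ)) ∞
      (fun m ↦ TotalSpace.mk' ℝ (E := Bundle.Trivial N ℝ) (b m)
        (g.inner (b m) (v m) (w m))) U x := by
    apply ContMDiffWithinAt.clm_bundle_apply₂ (F₁ := F) (F₂ := F)
    · exact ContMDiffAt.comp_contMDiffWithinAt x g.contMDiff.contMDiffAt (hb x hx)
    · exact hv x hx
    · exact hw x hx
  simp only [contMDiffWithinAt_totalSpace] at this
  exact this.2

lemma SmoothMetric.isInnerForm (g : SmoothMetric F N) (q : N) : IsInnerForm (g.inner q) :=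
  ⟨g.symm q, g.pos q⟩

lemma SmoothMetric.isSmoothMetricForm (g : SmoothMetric F N) :
    IsSmoothMetricForm (fun q ↦ g.inner q) where
  inner := g.isInnerForm
  smooth _ _ _ _ hX hY := g.contMDiffOn_inner (b := id) contMDiffOn_id hX hY

lemma IsSubmanifold.contMDiffOn_push {i : M → N} (hi : IsSubmanifold E F i) {X : VField E M}
    {U : Set M} (hX : SmoothFieldOn X U) :
    ContMDiffOn 𝓘(ℝ, E) (𝓘(ℝ, F).prod 𝓘(ℝ, F)) ∞
      (fun m ↦ (⟨i m, diffAt E F i m (X m)⟩ : TangentBundle 𝓘(ℝ, F) N)) U :=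
  (hi.1.contMDiff_tangentMap (m := ∞) (by simp)).comp_contMDiffOn hX

lemma IsSubmanifold.isSmoothMetricForm {i : M → N} (hi : IsSubmanifold E F i)
    (g : SmoothMetric F N) : IsSmoothMetricForm (inducedMetric (E := E) g i) where
  inner p := (g.isInnerForm (i p)).pullForm _ (hi.2 p)
  smooth _ _ _ _ hX hY :=
    g.contMDiffOn_inner hi.1.contMDiffOn (hi.contMDiffOn_push hX) (hi.contMDiffOn_push hY)

variable {p : M}

lemma contDiffAt_comp_chart {f : M → ℝ} {U : Set M} (hU : IsOpen U) (hp : p ∈ U)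
    (hf : ContMDiffOn 𝓘(ℝ, E) 𝓘(ℝ, ℝ) ∞ f U) :
    ContDiffAt ℝ ∞ (fun x ↦ f ((extChartAt 𝓘(ℝ, E) p).symm x)) (extChartAt 𝓘(ℝ, E) p p) := by
  have h1 := (hf p hp).contMDiffAt (hU.mem_nhds hp)
  rw [contMDiffAt_iff, ModelWithCorners.range_eq_univ, contDiffWithinAt_univ] at h1
  exact h1.2

/-- A map into the operators on a finite-dimensional space is smooth if all its evaluations are. -/
lemma contDiffAt_clm_of_apply {V W : Type*} [NormedAddCommGroup V] [NormedSpace ℝ V]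
    [FiniteDimensional ℝ V] [NormedAddCommGroup W] [NormedSpace ℝ W] {f : E → V →L[ℝ] W} {x : E}
    {n : WithTop ℕ∞} (h : ∀ v, ContDiffAt ℝ n (fun y ↦ f y v) x) : ContDiffAt ℝ n f x := by
  let e₁ := ContinuousLinearEquiv.ofFinrankEq
    (Module.finrank_fin_fun ℝ (n := Module.finrank ℝ V)).symm
  let e₂ := (e₁.arrowCongr (1 : W ≃L[ℝ] W)).trans
    (ContinuousLinearEquiv.piRing (Fin (Module.finrank ℝ V)))
  rw [← Function.id_comp f, ← e₂.symm_comp_self]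
  exact e₂.symm.contDiff.contDiffAt.comp x (contDiffAt_pi.mpr fun i ↦ h _)

lemma IsSmoothMetricForm.isMetricAt [FiniteDimensional ℝ E] {g : FormField E M}
    (hg : IsSmoothMetricForm g) (p : M) :
    IsMetricAt (coordForm g p) (extChartAt 𝓘(ℝ, E) p p) where
  diff := by
    suffices ContDiffAt ℝ ∞ (coordForm g p) (extChartAt 𝓘(ℝ, E) p p) from
      this.differentiableAt (by simp)
    refine contDiffAt_clm_of_apply fun u ↦ contDiffAt_clm_of_apply fun v ↦ ?_
    refine (contDiffAt_comp_chart (isOpen_extChartAt_source p) (mem_extChartAt_source p)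
      (hg.smooth _ _ _ (isOpen_extChartAt_source p) (constField_smooth u)
        (constField_smooth v))).congr_of_eventuallyEq ?_
    filter_upwards [eventually_mem_target (p := p)] with x hx
    rw [constField_symm u hx, constField_symm v hx, coordForm_apply]
  symm := by
    filter_upwards with x u v
    exact (hg.inner _).symm _ _
  inner := (hg.inner _).pullForm _ (by
    intro x y h
    have h' : chartDiff E p _ x = chartDiff E p _ y := h
    rw [chartDiff_self] at h'
    exact h')

lemma coordForm_self (g : FormField E M) (u v : E) :
    coordForm g p (extChartAt 𝓘(ℝ, E) p p) u v = g p u v := by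
  rw [coordForm_apply, chartDiff_self]
  have (q : M) (hq : q = p) : g q (u : E) (v : E) = g p u v := by rw [hq]
  exact this _ (extChartAt_to_inv p)

end SmoothForm

/-! ### Immersions in the preferred charts -/

section Immersion

variable {E : Type*} [NormedAddCommGroup E] [NormedSpace ℝ E]
  {M : Type*} [TopologicalSpace M] [ChartedSpace E M] [IsManifold 𝓘(ℝ, E) ∞ M]
  {F : Type*} [NormedAddCommGroup F] [NormedSpace ℝ F]
  {N : Type*} [TopologicalSpace N] [ChartedSpace F N] [IsManifold 𝓘(ℝ, F) ∞ N]
  {i : M → N} {p : M}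

lemma writtenInExtChartAt_self :
    writtenInExtChartAt 𝓘(ℝ, E) 𝓘(ℝ, F) p i (extChartAt 𝓘(ℝ, E) p p) =
      extChartAt 𝓘(ℝ, F) (i p) (i p) := by
  simp [writtenInExtChartAt]

lemma contDiffAt_writtenInExtChartAt (hi : ContMDiff 𝓘(ℝ, E) 𝓘(ℝ, F) ∞ i) :
    ContDiffAt ℝ ∞ (writtenInExtChartAt 𝓘(ℝ, E) 𝓘(ℝ, F) p i) (extChartAt 𝓘(ℝ, E) p p) := by
  have h1 := hi p
  rw [contMDiffAt_iff, ModelWithCorners.range_eq_univ, contDiffWithinAt_univ] at h1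
  exact h1.2

lemma diffAt_eq_fderiv (hi : ContMDiff 𝓘(ℝ, E) 𝓘(ℝ, F) ∞ i) (u : E) :
    (diffAt E F i p u : F) = fderiv ℝ (writtenInExtChartAt 𝓘(ℝ, E) 𝓘(ℝ, F) p i)
      (extChartAt 𝓘(ℝ, E) p p) u := by
  rw [diffAt, (hi.mdifferentiable (by simp) p).mfderiv, ModelWithCorners.range_eq_univ,
    fderivWithin_univ]
  rfl

/-- Near `p`, the map in the charts at `p` and `i p` has values in the chart domain and
represents `i`, and its differential represents that of `i`. -/
lemma eventually_chartDiff_comp (hi : ContMDiff 𝓘(ℝ, E) 𝓘(ℝ, F) ∞ i) :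
    ∀ᶠ x in 𝓝 (extChartAt 𝓘(ℝ, E) p p), x ∈ (extChartAt 𝓘(ℝ, E) p).target ∧
      writtenInExtChartAt 𝓘(ℝ, E) 𝓘(ℝ, F) p i x ∈ (extChartAt 𝓘(ℝ, F) (i p)).target ∧
      (extChartAt 𝓘(ℝ, F) (i p)).symm (writtenInExtChartAt 𝓘(ℝ, E) 𝓘(ℝ, F) p i x) =
        i ((extChartAt 𝓘(ℝ, E) p).symm x) ∧
      ∀ u : E, (chartDiff F (i p) (writtenInExtChartAt 𝓘(ℝ, E) 𝓘(ℝ, F) p i x)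
          (fderiv ℝ (writtenInExtChartAt 𝓘(ℝ, E) 𝓘(ℝ, F) p i) x u) : F) =
        diffAt E F i ((extChartAt 𝓘(ℝ, E) p).symm x) (chartDiff E p x u) := by
  set φ := extChartAt 𝓘(ℝ, E) p with hφ
  set ψ := extChartAt 𝓘(ℝ, F) (i p) with hψ
  set c := writtenInExtChartAt 𝓘(ℝ, E) 𝓘(ℝ, F) p i with hc
  have hcont : ContinuousAt (fun x ↦ i (φ.symm x)) (φ p) :=
    hi.continuous.continuousAt.comp (continuousAt_extChartAt_symm p)
  have hsrc : ∀ᶠ x in 𝓝 (φ p), i (φ.symm x) ∈ ψ.source :=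
    hcont.eventually_mem (by
      rw [hφ, extChartAt_to_inv]; exact extChartAt_source_mem_nhds (I := 𝓘(ℝ, F)) (i p))
  have hall : ∀ᶠ x in 𝓝 (φ p), x ∈ φ.target ∧ i (φ.symm x) ∈ ψ.source :=
    (eventually_mem_target (p := p)).and hsrc
  filter_upwards [hall.eventually_nhds] with x hx
  obtain ⟨hxt, hxs⟩ := hx.self_of_nhds
  have e (y : E) (hy : i (φ.symm y) ∈ ψ.source) : ψ.symm (c y) = i (φ.symm y) := ψ.left_inv hy
  have hct : c x ∈ ψ.target := ψ.map_source hxs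
  refine ⟨hxt, hct, e x hxs, fun u ↦ ?_⟩
  have dφ : MDifferentiableAt 𝓘(ℝ, E) 𝓘(ℝ, E) φ.symm x := by
    have := mdifferentiableWithinAt_extChartAt_symm (I := 𝓘(ℝ, E)) hxt
    rwa [ModelWithCorners.range_eq_univ, mdifferentiableWithinAt_univ] at this
  have dψ : MDifferentiableAt 𝓘(ℝ, F) 𝓘(ℝ, F) ψ.symm (c x) := by
    have := mdifferentiableWithinAt_extChartAt_symm (I := 𝓘(ℝ, F)) hct
    rwa [ModelWithCorners.range_eq_univ, mdifferentiableWithinAt_univ] at this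
  have di : MDifferentiableAt 𝓘(ℝ, E) 𝓘(ℝ, F) i (φ.symm x) := hi.mdifferentiable (by simp) _
  have dψ' : MDifferentiableAt 𝓘(ℝ, F) 𝓘(ℝ, F) ψ (i (φ.symm x)) :=
    mdifferentiableAt_extChartAt (by rwa [← extChartAt_source 𝓘(ℝ, F)])
  have dic := di.hasMFDerivAt.comp x dφ.hasMFDerivAt
  have dc : MDifferentiableAt 𝓘(ℝ, E) 𝓘(ℝ, F) c x :=
    dψ'.comp x (di.comp x dφ)
  have h2 := dψ.hasMFDerivAt.comp x dc.hasMFDerivAt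
  have h3 := h2.congr_of_eventuallyEq
    (f₁ := i ∘ φ.symm) (hx.mono fun y hy ↦ (e y hy.2).symm)
  have h4 := hasMFDerivAt_unique h3 dic
  rw [mfderiv_eq_fderiv] at h4
  exact congr($h4 u)

/-- `coordForm_apply` with the base point replaced by an equal one; the tangent spaces at the two
points are compared as copies of the model space. -/
lemma coordForm_apply_of_eq (g : FormField F N) {q q' : N} {y a' b' : F}
    (h : (extChartAt 𝓘(ℝ, F) q).symm y = q') {a b : TangentSpace 𝓘(ℝ, F) q'}
    (ha : (chartDiff F q y a' : F) = a) (hb : (chartDiff F q y b' : F) = b) :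
    coordForm g q y a' b' = g q' a b := by
  subst h
  rw [coordForm_apply]
  exact congr(g _ $ha $hb)

/-- The analogue of `coordForm_apply_of_eq` for endomorphism fields. -/
lemma chartDiff_coordEndo_of_eq (J : EndoField F N) {q q' : N} {y a' : F}
    (hy : y ∈ (extChartAt 𝓘(ℝ, F) q).target)
    (h : (extChartAt 𝓘(ℝ, F) q).symm y = q') {a : TangentSpace 𝓘(ℝ, F) q'}
    (ha : (chartDiff F q y a' : F) = a) :
    (chartDiff F q y (coordEndo J q y a') : F) = J q' a := by
  subst h
  refine (chartDiff_inverse hy _).trans ?_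
  exact congr(J _ $ha)

lemma eventually_coordForm_induced (g : SmoothMetric F N) (hi : ContMDiff 𝓘(ℝ, E) 𝓘(ℝ, F) ∞ i) :
    ∀ᶠ x in 𝓝 (extChartAt 𝓘(ℝ, E) p p), ∀ u v : E, coordForm (inducedMetric (E := E) g i) p x u v =
      coordForm (fun q ↦ g.inner q) (i p) (writtenInExtChartAt 𝓘(ℝ, E) 𝓘(ℝ, F) p i x)
        (fderiv ℝ (writtenInExtChartAt 𝓘(ℝ, E) 𝓘(ℝ, F) p i) x u)
        (fderiv ℝ (writtenInExtChartAt 𝓘(ℝ, E) 𝓘(ℝ, F) p i) x v) := by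
  filter_upwards [eventually_chartDiff_comp (p := p) hi] with x ⟨h1, h2, h3, h4⟩ u v
  rw [coordForm_apply_of_eq (fun q ↦ g.inner q) h3 (h4 u) (h4 v)]
  rfl

lemma coordEndo_self (J : EndoField F N) (q : N) (v : F) :
    (coordEndo J q (extChartAt 𝓘(ℝ, F) q q) v : F) = J q v := by
  have := chartDiff_coordEndo_of_eq J (mem_extChartAt_target (I := 𝓘(ℝ, F)) q)
    (extChartAt_to_inv q) (a' := v) (a := v) (by rw [chartDiff_self]; rfl)
  rw [chartDiff_self] at this
  exact this

end Immersion

/-! ### Locally conformal Kähler manifolds in the preferred charts -/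

section LCK

section

variable {F : Type*} [NormedAddCommGroup F] [NormedSpace ℝ F]
  {N : Type*} [TopologicalSpace N] [ChartedSpace F N] (q : N)

instance [FiniteDimensional ℝ F] : FiniteDimensional ℝ (TangentSpace 𝓘(ℝ, F) q) :=
  inferInstanceAs (FiniteDimensional ℝ F)

instance : T2Space (TangentSpace 𝓘(ℝ, F) q) := inferInstanceAs (T2Space F)

end

variable {F : Type*} [NormedAddCommGroup F] [NormedSpace ℝ F] [FiniteDimensional ℝ F]
  {N : Type*} [TopologicalSpace N] [ChartedSpace F N] [IsManifold 𝓘(ℝ, F) ∞ N]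

lemma IsAlmostHermitian.smoothFieldOn {g : SmoothMetric F N} {J : EndoField F N}
    (h : IsAlmostHermitian g J) {Y : VField F N} {U : Set N} (hY : SmoothFieldOn Y U) :
    SmoothFieldOn (fun q ↦ J q (Y q)) U :=
  ContMDiffOn.clm_bundle_apply (F₁ := F) (F₂ := F) h.smooth.contMDiffOn hY

lemma coordField_endo_constField (J : EndoField F N) {q : N} (u : F) {y : F}
    (hy : y ∈ (extChartAt 𝓘(ℝ, F) q).target) :
    coordField q (fun r ↦ J r (constField q u r)) y = coordEndo J q y u := by
  rw [coordField, constField_symm u hy]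
  rfl

lemma coordField_constField {q : N} (u : F) {y : F}
    (hy : y ∈ (extChartAt 𝓘(ℝ, F) q).target) : coordField q (constField q u) y = u := by
  rw [coordField, constField_symm u hy, inverse_chartDiff hy]

/-- In the preferred chart at `q`, a locally conformal Kähler manifold has the first-order data of a
locally conformal Kähler structure: testing the Kähler condition on fields which are constant in the
chart shows that `J` is parallel for the conformal metric. -/
lemma IsLCKWithLeeForm.isLCKAt {g : SmoothMetric F N} {J : EndoField F N}
    {η : (q : N) → TangentSpace 𝓘(ℝ, F) q →L[ℝ] ℝ} (h : IsLCKWithLeeForm g J η) (q : N) :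
    IsLCKAt (coordForm (fun q ↦ g.inner q) q) (coordEndo J q) (extChartAt 𝓘(ℝ, F) q q)
      (leeField g η q) := by
  have hG := g.isSmoothMetricForm.isMetricAt q
  have hJd : DifferentiableAt ℝ (coordEndo J q) (extChartAt 𝓘(ℝ, F) q q) := by
    suffices ContDiffAt ℝ ∞ (coordEndo J q) (extChartAt 𝓘(ℝ, F) q q) from
      this.differentiableAt (by simp)
    refine contDiffAt_clm_of_apply fun u ↦ ?_
    refine (contDiffAt_coordField (isOpen_extChartAt_source q) (mem_extChartAt_source q)
      (h.1.smoothFieldOn (constField_smooth u))).congr_of_eventuallyEq ?_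
    filter_upwards [eventually_mem_target (p := q)] with y hy
    rw [coordField_endo_constField J u hy]
  refine ⟨hG, hJd, fun v ↦ ?_, fun u v ↦ ?_, ?_⟩
  · rw [coordEndo_self, coordEndo_self]
    exact h.1.sq q v
  · rw [coordEndo_self, coordEndo_self]
    exact (coordForm_self (E := F) _ (J q u) (J q v)).trans
      ((h.1.isometry q u v).trans (coordForm_self (E := F) _ u v).symm)
  obtain ⟨U, f, hU, hqU, hf, hK, hη⟩ := h.2 q
  set y₀ := extChartAt 𝓘(ℝ, F) q q with hy₀
  set f' : F → ℝ := fun y ↦ f ((extChartAt 𝓘(ℝ, F) q).symm y) with hf'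
  have hfd : DifferentiableAt ℝ f' y₀ :=
    (contDiffAt_comp_chart hU hqU hf).differentiableAt (by simp)
  have hconf : ∀ᶠ y in 𝓝 y₀, coordForm (fun r ↦ Real.exp (-f r) • g.inner r) q y =
      Real.exp (-f' y) • coordForm (fun q ↦ g.inner q) q y := by
    filter_upwards with y
    rfl
  have hηf (v : F) : η q v = fderiv ℝ f' y₀ v :=
    (hη q hqU v).trans (mfderiv_eq_fderiv_chart
      ((hf.mdifferentiableOn (by simp) q hqU).mdifferentiableAt (hU.mem_nhds hqU)) v)
  have hB : sharp (coordForm (fun q ↦ g.inner q) q y₀) (fderiv ℝ f' y₀) = leeField g η q := by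
    refine hG.inner.eq_of_forall fun z ↦ ?_
    refine (hG.inner.sharp_apply _ z).trans ((hηf z).symm.trans ?_)
    exact ((g.isInnerForm q).sharp_apply (η q) z).symm.trans (coordForm_self (E := F) _ _ z).symm
  have hpar (w y : F) : fderiv ℝ (coordEndo J q) y₀ w y +
      flatChristoffel (coordForm (fun r ↦ Real.exp (-f r) • g.inner r) q) y₀ w
        (coordEndo J q y₀ y) =
      coordEndo J q y₀
        (flatChristoffel (coordForm (fun r ↦ Real.exp (-f r) • g.inner r) q) y₀ w y) := by
    have := hK (U ∩ (extChartAt 𝓘(ℝ, F) q).source) (constField q y)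
      (hU.inter (isOpen_extChartAt_source q)) inter_subset_left
      ((constField_smooth y).mono inter_subset_right) q ⟨hqU, mem_extChartAt_source q⟩ w
    have e1 : fderiv ℝ (coordField q (fun r ↦ J r (constField q y r))) y₀ w =
        fderiv ℝ (coordEndo J q) y₀ w y := by
      have h1 : coordField q (fun r ↦ J r (constField q y r)) =ᶠ[𝓝 y₀] fun x ↦ coordEndo J q x y :=
        (eventually_mem_target (p := q)).mono fun x hx ↦ coordField_endo_constField J y hx
      rw [h1.fderiv_eq, (hJd.hasFDerivAt.clm_apply (hasFDerivAt_const y y₀)).fderiv]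
      simp
    have e2 : fderiv ℝ (coordField q (constField q y)) y₀ w = 0 := by
      have h1 : coordField q (constField q y) =ᶠ[𝓝 y₀] fun x ↦ y :=
        (eventually_mem_target (p := q)).mono fun x hx ↦ coordField_constField y hx
      rw [h1.fderiv_eq]
      simp
    have e3 : coordField q (fun r ↦ J r (constField q y r)) y₀ = coordEndo J q y₀ y :=
      coordField_endo_constField J y (mem_extChartAt_target q)
    have e4 : coordField q (constField q y) y₀ = y :=
      coordField_constField y (mem_extChartAt_target q)
    have e5 : fderiv ℝ (coordField q (fun r ↦ J r (constField q y r))) y₀ w +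
        flatChristoffel (coordForm (fun r ↦ Real.exp (-f r) • g.inner r) q) y₀ w
          (coordField q (fun r ↦ J r (constField q y r)) y₀) =
        coordEndo J q y₀ (fderiv ℝ (coordField q (constField q y)) y₀ w +
          flatChristoffel (coordForm (fun r ↦ Real.exp (-f r) • g.inner r) q) y₀ w
            (coordField q (constField q y) y₀)) :=
      this.trans (coordEndo_self J q _).symm
    rwa [e1, e2, e3, e4, zero_add] at e5
  intro w y
  have := hG.fderiv_of_parallel hfd hconf hpar w y
  have hGB (v : F) : coordForm (fun q ↦ g.inner q) q y₀ (leeField g η q) v = fderiv ℝ f' y₀ v := by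
    rw [← hB, hG.inner.sharp_apply]
  rw [hB] at this
  rw [hGB, hGB, this]

end LCK

/-! ### Smoothness of orthogonal projections to a smooth distribution -/

section Matrix

variable {k : ℕ}

lemma contDiff_det_comp {V : Type*} [NormedAddCommGroup V] [NormedSpace ℝ V]
    {f : V → Matrix (Fin k) (Fin k) ℝ} {n : WithTop ℕ∞} (hf : ∀ a b, ContDiff ℝ n fun x ↦ f x a b) :
    ContDiff ℝ n fun x ↦ (f x).det := by
  simp only [Matrix.det_apply']
  exact ContDiff.sum fun σ _ ↦ contDiff_const.mul (contDiff_prod fun a _ ↦ hf _ _)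

lemma contDiffAt_matrix_inv_apply {A : Fin k → Fin k → ℝ} (hA : (Matrix.of A).det ≠ 0)
    {n : WithTop ℕ∞} (a b : Fin k) :
    ContDiffAt ℝ n (fun A : Fin k → Fin k → ℝ ↦ (Matrix.of A)⁻¹ a b) A := by
  have h0 (a b : Fin k) : ContDiff ℝ n fun A : Fin k → Fin k → ℝ ↦ Matrix.of A a b :=
    (contDiff_apply_apply ℝ ℝ a b)
  have h1 : ContDiff ℝ n fun A : Fin k → Fin k → ℝ ↦ (Matrix.of A).det := contDiff_det_comp h0
  have h2 : ContDiff ℝ n fun A : Fin k → Fin k → ℝ ↦ (Matrix.of A).adjugate a b := by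
    simp only [Matrix.adjugate_apply]
    refine contDiff_det_comp fun c d ↦ ?_
    by_cases hc : c = b
    · subst hc; simp only [Matrix.updateRow_self]; exact contDiff_const
    · simp only [Matrix.updateRow_ne hc]; exact h0 c d
  have h3 : (fun A : Fin k → Fin k → ℝ ↦ (Matrix.of A)⁻¹ a b) =
      fun A ↦ ((Matrix.of A).det)⁻¹ * (Matrix.of A).adjugate a b := by
    ext A
    rw [Matrix.inv_def, Matrix.smul_apply, Ring.inverse_eq_inv', smul_eq_mul]
  rw [h3]
  exact (h1.contDiffAt.inv hA).mul h2.contDiffAt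

end Matrix

section Projection

variable {T : Type*} [AddCommGroup T] [Module ℝ T] [TopologicalSpace T]
  [IsTopologicalAddGroup T] [ContinuousSMul ℝ T] [FiniteDimensional ℝ T] [T2Space T]
  {b : T →L[ℝ] T →L[ℝ] ℝ} {k : ℕ} {s : Fin k → T}

lemma IsInnerForm.det_gram_ne_zero (hb : IsInnerForm b) (hs : LinearIndependent ℝ s) :
    (Matrix.of fun i j ↦ b (s i) (s j)).det ≠ 0 := by
  intro h
  obtain ⟨w, hw, h0⟩ := Matrix.exists_vecMul_eq_zero_iff.2 h
  apply hw
  have h1 (j : Fin k) : b (∑ i, w i • s i) (s j) = 0 := by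
    have := congrFun h0 j
    simpa [Matrix.vecMul, dotProduct] using this
  have h2 : ∑ i, w i • s i = 0 := hb.eq_zero_of_self (by
    rw [map_sum (b (∑ i, w i • s i))]
    simp only [map_smul, h1, smul_zero, Finset.sum_const_zero])
  ext i
  exact Fintype.linearIndependent_iff.1 hs w h2 i

lemma IsInnerForm.orthProj_eq_sum (hb : IsInnerForm b) (hs : LinearIndependent ℝ s) (x : T) :
    orthProj b (Submodule.span ℝ (Set.range s)) x =
      ∑ j, (∑ i, b x (s i) * (Matrix.of fun i j ↦ b (s i) (s j))⁻¹ i j) • s j := by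
  refine hb.eq_orthProj (Submodule.sum_mem _ fun j _ ↦ Submodule.smul_mem _ _
    (Submodule.subset_span ⟨j, rfl⟩)) fun w hw ↦ ?_
  set A := Matrix.of fun i j ↦ b (s i) (s j) with hA
  have hu : A⁻¹ * A = 1 := Matrix.nonsing_inv_mul A (hb.det_gram_ne_zero hs).isUnit
  have key (l : Fin k) : b (∑ j, (∑ i, b x (s i) * A⁻¹ i j) • s j) (s l) = b x (s l) := by
    have : Matrix.vecMul (Matrix.vecMul (fun i ↦ b x (s i)) A⁻¹) A = fun i ↦ b x (s i) := by
      rw [Matrix.vecMul_vecMul, hu, Matrix.vecMul_one]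
    have := congrFun this l
    simpa [Matrix.vecMul, dotProduct, hA] using this
  induction hw using Submodule.span_induction with
  | mem w hw => obtain ⟨l, rfl⟩ := hw; exact key l
  | zero => simp
  | add y z _ _ hy hz => rw [map_add, map_add, hy, hz]
  | smul a y _ hy => rw [map_smul, map_smul, hy]

end Projection

section Distribution

variable {E : Type*} [NormedAddCommGroup E] [NormedSpace ℝ E] [FiniteDimensional ℝ E]
  {M : Type*} [TopologicalSpace M] [ChartedSpace E M] [IsManifold 𝓘(ℝ, E) ∞ M]
  {g : FormField E M} {D : TangentDistribution E M}

lemma smoothFieldOn_of_local {X : VField E M} {U : Set M}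
    (h : ∀ q ∈ U, ∃ V, IsOpen V ∧ q ∈ V ∧ SmoothFieldOn X (U ∩ V)) : SmoothFieldOn X U := by
  intro q hq
  obtain ⟨V, hV, hqV, hX⟩ := h q hq
  exact (contMDiffWithinAt_inter (hV.mem_nhds hqV)).1 (hX q ⟨hq, hqV⟩)

/-- The orthogonal projection of a smooth vector field to a smooth distribution is smooth: in a
local frame its coefficients are given by the inverse of the Gram matrix. -/
lemma IsSmoothDistribution.smoothFieldOn_orthProj (hD : IsSmoothDistribution D)
    (hg : IsSmoothMetricForm g) {X : VField E M} {U : Set M} (hU : IsOpen U)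
    (hX : SmoothFieldOn X U) : SmoothFieldOn (fun q ↦ orthProj (g q) (D q) (X q)) U := by
  refine smoothFieldOn_of_local fun q hq ↦ ?_
  obtain ⟨V, hV, hqV, k, s, hs, hsD⟩ := hD q
  refine ⟨V, hV, hqV, ?_⟩
  have hUV := hU.inter hV
  have hs' (i) : SmoothFieldOn (s i) (U ∩ V) := (hs i).mono inter_subset_right
  have hX' : SmoothFieldOn X (U ∩ V) := hX.mono inter_subset_left
  have hsum : ContMDiffOn 𝓘(ℝ, E) (𝓘(ℝ, E).prod 𝓘(ℝ, E)) ∞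
      (fun r ↦ (⟨r, ∑ j, (∑ i, g r (X r) (s i r) *
        (Matrix.of fun i j ↦ g r (s i r) (s j r))⁻¹ i j) • s j r⟩ : TangentBundle 𝓘(ℝ, E) M))
      (U ∩ V) := by
    refine ContMDiffOn.sum_section fun j _ ↦ ContMDiffOn.smul_section ?_ (hs' j)
    refine contMDiffOn_finsetSum fun i _ ↦ (hg.smooth _ _ _ hUV hX' (hs' i)).mul ?_
    intro r hr
    have hgram : ContMDiffWithinAt 𝓘(ℝ, E) 𝓘(ℝ, Fin k → Fin k → ℝ) ∞
        (fun r i j ↦ g r (s i r) (s j r)) (U ∩ V) r :=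
      contMDiffWithinAt_pi_space.2 fun i ↦ contMDiffWithinAt_pi_space.2 fun j ↦
        hg.smooth _ _ _ hUV (hs' i) (hs' j) r hr
    have hinv := contDiffAt_matrix_inv_apply (n := ∞)
      ((hg.inner r).det_gram_ne_zero (hsD r hr.2).1) i j
    exact hinv.contMDiffAt.comp_contMDiffWithinAt r hgram
  refine hsum.congr fun r hr ↦ ?_
  have h : orthProj (g r) (D r) (X r) = ∑ j, (∑ i, g r (X r) (s i r) *
      (Matrix.of fun i j ↦ g r (s i r) (s j r))⁻¹ i j) • s j r := by
    rw [← (hsD r hr.2).2, (hg.inner r).orthProj_eq_sum (hsD r hr.2).1]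
  exact congrArg (TotalSpace.mk r) h

/-- Combining the vectors of a local frame with constant coefficients extends a vector of `D` to a
local section of `D`. -/
lemma IsSmoothDistribution.exists_section (hD : IsSmoothDistribution D) {p : M}
    {u : TangentSpace 𝓘(ℝ, E) p} (hu : u ∈ D p) :
    ∃ (U : Set M) (X : VField E M), IsOpen U ∧ p ∈ U ∧ IsSectionOn D X U ∧ X p = u := by
  obtain ⟨V, hV, hpV, k, s, hs, hsD⟩ := hD p
  rw [← (hsD p hpV).2, Submodule.mem_span_range_iff_exists_fun] at hu
  obtain ⟨a, rfl⟩ := hu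
  refine ⟨V, fun q ↦ ∑ i, a i • s i q, hV, hpV, ⟨?_, fun q hq ↦ ?_⟩, rfl⟩
  · exact ContMDiffOn.sum_section fun i _ ↦ ContMDiffOn.const_smul_section (hs i)
  · rw [← (hsD q hq).2]
    exact Submodule.sum_mem _ fun i _ ↦ Submodule.smul_mem _ _ (Submodule.subset_span ⟨i, rfl⟩)

lemma smoothFieldOn_sub {X Y : VField E M} {U : Set M} (hX : SmoothFieldOn X U)
    (hY : SmoothFieldOn Y U) : SmoothFieldOn (fun q ↦ X q - Y q) U :=
  ContMDiffOn.sub_section hX hY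

/-- The orthogonal complement of a smooth distribution is smooth. Near `p` a frame is given by the
projections of the fields which are constant in the chart at `p`, with values a basis of the
complement at `p`. -/
lemma IsSmoothDistribution.orthCompl (hD : IsSmoothDistribution D) (hg : IsSmoothMetricForm g) :
    IsSmoothDistribution fun p ↦ orthCompl (g p) (D p) := by
  intro p
  obtain ⟨V, hV, hpV, k, s, hs, hsD⟩ := hD p
  set W := _root_.orthCompl (g p) (D p) with hW
  set m := Module.finrank ℝ W
  let w : Module.Basis (Fin m) ℝ W := Module.finBasis ℝ W
  let w' : Fin m → E := fun j ↦ (w j).1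
  let S := (extChartAt 𝓘(ℝ, E) p).source
  have hS : IsOpen S := isOpen_extChartAt_source p
  let t : Fin m → VField E M := fun j q ↦
    constField p (w' j) q - orthProj (g q) (D q) (constField p (w' j) q)
  have ht (j) : SmoothFieldOn (t j) S := smoothFieldOn_sub (constField_smooth _)
    (hD.smoothFieldOn_orthProj hg hS (constField_smooth _))
  have htp (j) : t j p = w j := by
    have h1 : constField p (w' j) p = w j := constField_self (w' j)
    simp only [t, h1]
    have h2 : orthProj (g p) (D p) (w j) = 0 :=
      (hg.inner p).eq_orthProj (D p).zero_mem fun v hv ↦ by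
        rw [(w j).2 v hv, map_zero, zero_apply]
    rw [h2, sub_zero]
  let e := trivializationAt E (TangentSpace 𝓘(ℝ, E)) p
  have hSe : S = e.baseSet := by
    rw [TangentBundle.trivializationAt_baseSet]; exact extChartAt_source 𝓘(ℝ, E) p
  have hpe : p ∈ e.baseSet := hSe ▸ mem_extChartAt_source p
  -- linear independence is an open condition on the coordinates of the fields `t j`
  let τ : M → Fin m → E := fun q j ↦ (e ⟨q, t j q⟩).2
  have hτ : ContinuousAt τ p := by
    refine continuousAt_pi.2 fun j ↦ ?_
    have h1 := (e.contMDiffAt_section_iff (IB := 𝓘(ℝ, E)) (n := ∞) (s := t j) hpe).1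
      ((ht j p (mem_extChartAt_source p)).contMDiffAt (hS.mem_nhds (mem_extChartAt_source p)))
    exact h1.continuousAt
  have hlin {q : M} (hq : q ∈ e.baseSet) :
      LinearIndependent ℝ (τ q) ↔ LinearIndependent ℝ (fun j ↦ t j q) := by
    have : τ q = (e.continuousLinearEquivAt ℝ q hq).toLinearEquiv ∘ fun j ↦ t j q := rfl
    rw [this]
    exact LinearMap.linearIndependent_iff _ (LinearEquiv.ker _)
  have hτp : LinearIndependent ℝ (τ p) := by
    rw [hlin hpe]
    have : (fun j ↦ t j p) = W.subtype ∘ w := funext fun j ↦ htp j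
    rw [this]
    exact w.linearIndependent.map' _ (Submodule.ker_subtype _)
  have hev : ∀ᶠ q in 𝓝 p, LinearIndependent ℝ (τ q) ∧ q ∈ S ∧ q ∈ V :=
    (hτ.eventually (isOpen_setOfPred_linearIndependent.eventually_mem hτp)).and
      ((hS.eventually_mem (mem_extChartAt_source p)).and (hV.eventually_mem hpV))
  obtain ⟨O, hO, hOo, hpO⟩ := eventually_nhds_iff.1 hev
  refine ⟨O, hOo, hpO, m, t, fun j ↦ (ht j).mono fun q hq ↦ (hO q hq).2.1, fun q hq ↦ ?_⟩
  obtain ⟨h1, h2, h3⟩ := hO q hq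
  have hli := (hlin (hSe ▸ h2)).1 h1
  refine ⟨hli, Submodule.eq_of_le_of_finrank_eq ?_ ?_⟩
  · rw [Submodule.span_le]
    rintro _ ⟨j, rfl⟩
    exact (hg.inner q).sub_orthProj_mem _ _
  -- the ranks agree because that of `D` is constant on `V`
  · have d (r : M) (hr : r ∈ V) : Module.finrank ℝ (D r) = k := by
      rw [← (hsD r hr).2, finrank_span_eq_card (hsD r hr).1, Fintype.card_fin]
    have e1 := (hg.inner q).finrank_add_finrank_orthCompl (D q)
    have e2 := (hg.inner p).finrank_add_finrank_orthCompl (D p)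
    have e3 : Module.finrank ℝ (TangentSpace 𝓘(ℝ, E) q) =
      Module.finrank ℝ (TangentSpace 𝓘(ℝ, E) p) := rfl
    rw [d q h3] at e1
    rw [d p hpV, ← hW] at e2
    rw [finrank_span_eq_card hli, Fintype.card_fin]
    change Module.finrank ℝ W = Module.finrank ℝ (_root_.orthCompl (g q) (D q))
    omega

end Distribution

/-! ### The totally real foliation of a CR-submanifold -/

section Submanifold

variable {F : Type*} [NormedAddCommGroup F] [NormedSpace ℝ F] [FiniteDimensional ℝ F]
  {N : Type*} [TopologicalSpace N] [ChartedSpace F N] [IsManifold 𝓘(ℝ, F) ∞ N]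
  {E : Type*} [NormedAddCommGroup E] [NormedSpace ℝ E] [FiniteDimensional ℝ E]
  {M : Type*} [TopologicalSpace M] [ChartedSpace E M] [IsManifold 𝓘(ℝ, E) ∞ M]
  {g : SmoothMetric F N} {J : EndoField F N} {η : (q : N) → TangentSpace 𝓘(ℝ, F) q →L[ℝ] ℝ}
  {i : M → N} {D : TangentDistribution E M} {p : M}

/-- The second derivative of the immersion `i` at `p` in the preferred charts, corrected by the
Christoffel symbols of `g`. Its normal component is the second fundamental form. -/
noncomputable def coordHessian (g : SmoothMetric F N) (i : M → N) (p : M)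
    (u v : TangentSpace 𝓘(ℝ, E) p) : TangentSpace 𝓘(ℝ, F) (i p) :=
  (hessianAlong (E := E) (F := F) (coordForm (fun q ↦ g.inner q) (i p))
    (writtenInExtChartAt 𝓘(ℝ, E) 𝓘(ℝ, F) p i) (extChartAt 𝓘(ℝ, E) p p) u v : F)

lemma secondFundamentalForm_eq (hi : IsSubmanifold E F i) (u v : TangentSpace 𝓘(ℝ, E) p) :
    secondFundamentalForm g i p u v =
      orthProj (g.inner (i p)) (normalSpace E g i p) (coordHessian g i p u v) := by
  have h : coordHessian g i p u v =
      (fderiv ℝ (fderiv ℝ (writtenInExtChartAt 𝓘(ℝ, E) 𝓘(ℝ, F) p i)) (extChartAt 𝓘(ℝ, E) p p) u v +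
        flatChristoffel (coordForm (fun q ↦ g.inner q) (i p)) (extChartAt 𝓘(ℝ, F) (i p) (i p))
          (diffAt E F i p u) (diffAt E F i p v) : F) := by
    rw [diffAt_eq_fderiv hi.1 u, diffAt_eq_fderiv hi.1 v, ← writtenInExtChartAt_self (E := E)]
    rfl
  rw [h]
  rfl

/-- `IsLCKWithLeeForm.isLCKAt` at `i p`, with the base point written as the value of the
representative of `i`. -/
lemma IsLCKWithLeeForm.isLCKAt_written (hN : IsLCKWithLeeForm g J η) (i : M → N) (p : M) :
    IsLCKAt (coordForm (fun q ↦ g.inner q) (i p)) (coordEndo J (i p))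
      (writtenInExtChartAt 𝓘(ℝ, E) 𝓘(ℝ, F) p i (extChartAt 𝓘(ℝ, E) p p)) (leeField g η (i p)) := by
  rw [writtenInExtChartAt_self]
  exact hN.isLCKAt (i p)

lemma coordForm_written (g : SmoothMetric F N) (a b : F) :
    coordForm (fun q ↦ g.inner q) (i p)
      (writtenInExtChartAt 𝓘(ℝ, E) 𝓘(ℝ, F) p i (extChartAt 𝓘(ℝ, E) p p)) a b =
      g.inner (i p) a b := by
  rw [writtenInExtChartAt_self]
  exact coordForm_self (E := F) _ a b

lemma coordEndo_written (J : EndoField F N) (a : F) :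
    (coordEndo J (i p)
      (writtenInExtChartAt 𝓘(ℝ, E) 𝓘(ℝ, F) p i (extChartAt 𝓘(ℝ, E) p p)) a : F) = J (i p) a := by
  rw [writtenInExtChartAt_self]
  exact coordEndo_self J (i p) a

lemma IsCRSubmanifold.endo_mem_normalSpace (hM : IsCRSubmanifold g J i D)
    {t : TangentSpace 𝓘(ℝ, E) p} (ht : t ∈ perpDistribution g i D p) :
    J (i p) (diffAt E F i p t) ∈ normalSpace E g i p :=
  hM.totallyReal p (Submodule.mem_map_of_mem (Submodule.mem_map_of_mem ht))

lemma IsCRSubmanifold.exists_endo_eq (hM : IsCRSubmanifold g J i D)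
    {v : TangentSpace 𝓘(ℝ, E) p} (hv : v ∈ D p) :
    ∃ v' ∈ D p, J (i p) (diffAt E F i p v') = diffAt E F i p v := by
  have h : diffAt E F i p v ∈ JImage J i D p := by
    rw [hM.holomorphic]; exact Submodule.mem_map_of_mem hv
  obtain ⟨_, ⟨v', hv', rfl⟩, h⟩ := h
  exact ⟨v', hv', h⟩

lemma IsCRSubmanifold.exists_diffAt_eq (hM : IsCRSubmanifold g J i D)
    {v : TangentSpace 𝓘(ℝ, E) p} (hv : v ∈ D p) :
    ∃ v' ∈ D p, diffAt E F i p v' = J (i p) (diffAt E F i p v) := by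
  have h : J (i p) (diffAt E F i p v) ∈ (D p).map (diffAt E F i p).toLinearMap := by
    rw [← hM.holomorphic]
    exact Submodule.mem_map_of_mem (Submodule.mem_map_of_mem hv)
  obtain ⟨v', hv', h⟩ := h
  exact ⟨v', hv', h⟩

/-- The representative of a section of `D^⊥` in the chart at `p` is totally real near `p`. -/
lemma IsCRSubmanifold.isTotallyRealAt (hM : IsCRSubmanifold g J i D) {Y : VField E M} {U : Set M}
    (hU : IsOpen U) (hp : p ∈ U) (hY : IsSectionOn (perpDistribution g i D) Y U) :
    IsTotallyRealAt (coordForm (fun q ↦ g.inner q) (i p)) (coordEndo J (i p))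
      (writtenInExtChartAt 𝓘(ℝ, E) 𝓘(ℝ, F) p i) (extChartAt 𝓘(ℝ, E) p p) (coordField p Y) where
  diff := (contDiffAt_coordField hU hp hY.1).differentiableAt (by simp)
  normal := by
    have hUe : ∀ᶠ x in 𝓝 (extChartAt 𝓘(ℝ, E) p p), (extChartAt 𝓘(ℝ, E) p).symm x ∈ U :=
      (continuousAt_extChartAt_symm p).eventually_mem (by
        rw [extChartAt_to_inv]; exact hU.mem_nhds hp)
    filter_upwards [eventually_chartDiff_comp (p := p) hM.submanifold.1, hUe]
      with x ⟨h1, h2, h3, h4⟩ hx v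
    have e1 := h4 (coordField p Y x)
    rw [chartDiff_coordField Y h1] at e1
    rw [coordForm_apply_of_eq (fun q ↦ g.inner q) h3 (chartDiff_coordEndo_of_eq J h2 h3 e1) (h4 v)]
    exact hM.endo_mem_normalSpace (hY.2 _ hx) _ ⟨_, rfl⟩

/-- The totally real distribution of a CR-submanifold of a locally conformal Kähler manifold is
involutive. -/
lemma IsCRSubmanifold.isInvolutive (hN : IsLCKWithLeeForm g J η) (hM : IsCRSubmanifold g J i D) :
    IsInvolutive (perpDistribution g i D) := by
  intro U X Y hU hX hY p hp w hw
  obtain ⟨w', hw', hww'⟩ := hM.exists_endo_eq hw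
  have hL := hN.isLCKAt_written (E := E) i p
  have hd (u : E) := diffAt_eq_fderiv (p := p) hM.submanifold.1 u
  have hperp {Z : VField E M} (hZ : IsSectionOn (perpDistribution g i D) Z U) {v : E}
      (hv : v ∈ D p) : g.inner (i p) (diffAt E F i p v) (diffAt E F i p (Z p)) = 0 :=
    (g.symm (i p) _ _).trans (hZ.2 p hp v hv)
  have := hL.bracket_totallyReal (contDiffAt_writtenInExtChartAt hM.submanifold.1)
    (hM.isTotallyRealAt hU hp hX) (hM.isTotallyRealAt hU hp hY) (v := w) (v' := w')
    (by rw [coordEndo_written, ← hd w', ← hd w]; exact hww')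
    (by rw [coordForm_written, coordField_self, ← hd w, ← hd (X p)]; exact hperp hX hw)
    (by rw [coordForm_written, coordField_self, ← hd w, ← hd (Y p)]; exact hperp hY hw)
    (by rw [coordForm_written, coordField_self, ← hd w', ← hd (X p)]; exact hperp hX hw')
    (by rw [coordForm_written, coordField_self, ← hd w', ← hd (Y p)]; exact hperp hY hw')
  rw [coordForm_written, coordField_self, coordField_self, ← hd, ← hd w] at this
  rw [mlieBracket_eq]
  exact this

/-- The canonical totally real foliation, with tangent distribution `D^⊥`. -/
noncomputable def IsCRSubmanifold.foliation (hN : IsLCKWithLeeForm g J η)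
    (hM : IsCRSubmanifold g J i D) : Foliation E M where
  tangent := perpDistribution g i D
  smooth := hM.smooth.orthCompl (hM.submanifold.isSmoothMetricForm g)
  involutive := hM.isInvolutive hN

end Submanifold

/-! ### The Levi-Civita connection of the induced metric and bundle-like metrics -/

section LeviCivita

variable {E : Type*} [NormedAddCommGroup E] [NormedSpace ℝ E] [FiniteDimensional ℝ E]
  {M : Type*} [TopologicalSpace M] [ChartedSpace E M] [IsManifold 𝓘(ℝ, E) ∞ M]
  {g : FormField E M} {p : M} {U : Set M}

lemma IsMetricAt.flatChristoffel_add_left {G : E → E →L[ℝ] E →L[ℝ] ℝ} {x₀ : E}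
    (hG : IsMetricAt G x₀) (u v w : E) :
    flatChristoffel G x₀ (u + v) w = flatChristoffel G x₀ u w + flatChristoffel G x₀ v w :=
  hG.inner.eq_of_forall fun z ↦ by
    simp only [map_add, add_apply, hG.flatChristoffel_apply]
    ring

namespace IsSmoothMetricForm

lemma covDeriv_add (hg : IsSmoothMetricForm g) (Y : VField E M) (u v : TangentSpace 𝓘(ℝ, E) p) :
    covDeriv g Y p (u + v) = covDeriv g Y p u + covDeriv g Y p v := by
  have h (u v : E) : fderiv ℝ (coordField p Y) (extChartAt 𝓘(ℝ, E) p p) (u + v) +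
      flatChristoffel (coordForm g p) (extChartAt 𝓘(ℝ, E) p p) (u + v)
        (coordField p Y (extChartAt 𝓘(ℝ, E) p p)) =
      (fderiv ℝ (coordField p Y) (extChartAt 𝓘(ℝ, E) p p) u +
        flatChristoffel (coordForm g p) (extChartAt 𝓘(ℝ, E) p p) u
          (coordField p Y (extChartAt 𝓘(ℝ, E) p p))) +
      (fderiv ℝ (coordField p Y) (extChartAt 𝓘(ℝ, E) p p) v +
        flatChristoffel (coordForm g p) (extChartAt 𝓘(ℝ, E) p p) v
          (coordField p Y (extChartAt 𝓘(ℝ, E) p p))) := by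
    rw [(hg.isMetricAt p).flatChristoffel_add_left, map_add, add_add_add_comm]
  exact h u v

/-- The Levi-Civita connection is torsion-free. -/
lemma mlieBracket_eq_covDeriv (hg : IsSmoothMetricForm g) (X Y : VField E M) :
    mlieBracket 𝓘(ℝ, E) X Y p = covDeriv g Y p (X p) - covDeriv g X p (Y p) := by
  have h (u v : E) : fderiv ℝ (coordField p Y) (extChartAt 𝓘(ℝ, E) p p) u -
      fderiv ℝ (coordField p X) (extChartAt 𝓘(ℝ, E) p p) v =
      (fderiv ℝ (coordField p Y) (extChartAt 𝓘(ℝ, E) p p) u +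
        flatChristoffel (coordForm g p) (extChartAt 𝓘(ℝ, E) p p) u v) -
      (fderiv ℝ (coordField p X) (extChartAt 𝓘(ℝ, E) p p) v +
        flatChristoffel (coordForm g p) (extChartAt 𝓘(ℝ, E) p p) v u) := by
    rw [(hg.isMetricAt p).flatChristoffel_comm u v]
    abel
  rw [mlieBracket_eq, covDeriv_eq, covDeriv_eq, coordField_self, coordField_self]
  exact h (X p) (Y p)

/-- The Levi-Civita connection is metric. -/
lemma mfderiv_apply (hg : IsSmoothMetricForm g) (hU : IsOpen U) (hp : p ∈ U) {Y Z : VField E M}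
    (hY : SmoothFieldOn Y U) (hZ : SmoothFieldOn Z U) (u : TangentSpace 𝓘(ℝ, E) p) :
    (mfderiv 𝓘(ℝ, E) 𝓘(ℝ, ℝ) (fun q ↦ g q (Y q) (Z q)) p u : ℝ) =
      g p (covDeriv g Y p u) (Z p) + g p (Y p) (covDeriv g Z p u) := by
  have hd : MDifferentiableAt 𝓘(ℝ, E) 𝓘(ℝ, ℝ) (fun q ↦ g q (Y q) (Z q)) p :=
    ((hg.smooth U Y Z hU hY hZ).mdifferentiableOn (by simp) p hp).mdifferentiableAt
      (hU.mem_nhds hp)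
  refine (mfderiv_eq_fderiv_chart hd u).trans ?_
  have hev : (fun x ↦ (fun q ↦ g q (Y q) (Z q)) ((extChartAt 𝓘(ℝ, E) p).symm x))
      =ᶠ[𝓝 (extChartAt 𝓘(ℝ, E) p p)]
      fun x ↦ coordForm g p (id x) (coordField p Y x) (coordField p Z x) := by
    filter_upwards [eventually_mem_target (p := p)] with x hx
    rw [coordForm_apply, id_eq, chartDiff_coordField Y hx, chartDiff_coordField Z hx]
  rw [hev.fderiv_eq]
  refine (((hg.isMetricAt p).hasFDerivAt_along (c := id) differentiableAt_id
    ((contDiffAt_coordField hU hp hY).differentiableAt (by simp))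
    ((contDiffAt_coordField hU hp hZ).differentiableAt (by simp))).2 u).trans ?_
  have h (W : VField E M) (u : E) : covDerivAlong (coordForm g p) id (coordField p W)
      (extChartAt 𝓘(ℝ, E) p p) u = covDeriv g W p u := by
    rw [covDerivAlong, fderiv_id]
    rfl
  have h' (a b a' b' : E) (ha : a = a') (hb : b = b') :
      coordForm g p (id (extChartAt 𝓘(ℝ, E) p p)) a b = g p a' b' := by
    rw [ha, hb]; exact coordForm_self g _ _
  exact congrArg₂ (· + ·) (h' _ _ _ _ (h Y u) (coordField_self Z))
    (h' _ _ _ _ (coordField_self Y) (h Z u))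

end IsSmoothMetricForm

/-- For fields `Y`, `Z` orthogonal to the leaves, the defect of parallelism of the metric under the
intrinsic connection is the Lie derivative of the metric along the component `Q X` of `X` tangent to
the leaves: since `∇` is torsion-free, `∇_{Q^⊥ X} Y + [Q X, Y] = ∇_X Y - ∇_Y (Q X)`. -/
lemma Foliation.intrinsicConnection_parallel_iff (𝓕 : Foliation E M) (hg : IsSmoothMetricForm g)
    (hU : IsOpen U) (hp : p ∈ U) {X Y Z : VField E M}
    (hY : IsSectionOn (𝓕.transversal g) Y U) (hZ : IsSectionOn (𝓕.transversal g) Z U) :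
    (mfderiv 𝓘(ℝ, E) 𝓘(ℝ, ℝ) (fun q ↦ g q (Y q) (Z q)) p (X p) : ℝ) =
      g p (𝓕.intrinsicConnection g X Y p) (Z p) + g p (Y p) (𝓕.intrinsicConnection g X Z p) ↔
      g p (covDeriv g (𝓕.tangentPart g X) p (Y p)) (Z p) +
        g p (covDeriv g (𝓕.tangentPart g X) p (Z p)) (Y p) = 0 := by
  have hsum : X p = 𝓕.transversalPart g X p + 𝓕.tangentPart g X p := by
    have h := (hg.inner p).orthProj_orthCompl (𝓕.tangent p) (X p)
    change X p = orthProj (g p) (orthCompl (g p) (𝓕.tangent p)) (X p) +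
      orthProj (g p) (𝓕.tangent p) (X p)
    rw [h, sub_add_cancel]
  have hdefect (W V : VField E M) (hV : V p ∈ 𝓕.transversal g p) :
      g p (𝓕.intrinsicConnection g X W p) (V p) = g p (covDeriv g W p (X p)) (V p) -
        g p (covDeriv g (𝓕.tangentPart g X) p (W p)) (V p) := by
    refine ((hg.inner p).orthProj_apply (𝓕.transversal g p) _ hV).trans ?_
    change g p (covDeriv g W p (𝓕.transversalPart g X p) +
      mlieBracket 𝓘(ℝ, E) (𝓕.tangentPart g X) W p) (V p) = _
    rw [hg.mlieBracket_eq_covDeriv, ← add_sub_assoc, ← hg.covDeriv_add, ← hsum, map_sub, sub_apply]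
  have key : g p (covDeriv g Y p (X p)) (Z p) + g p (Y p) (covDeriv g Z p (X p)) =
      g p (𝓕.intrinsicConnection g X Y p) (Z p) + g p (Y p) (𝓕.intrinsicConnection g X Z p) +
      (g p (covDeriv g (𝓕.tangentPart g X) p (Y p)) (Z p) +
        g p (covDeriv g (𝓕.tangentPart g X) p (Z p)) (Y p)) := by
    rw [hdefect Y Z (hZ.2 p hp), (hg.inner p).symm (Y p) (𝓕.intrinsicConnection g X Z p),
      hdefect Z Y (hY.2 p hp), (hg.inner p).symm (Y p) (covDeriv g Z p (X p))]
    ring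
  have hd := (hg.mfderiv_apply hU hp hY.1 hZ.1 (X p)).trans key
  exact ⟨fun h ↦ add_eq_left.1 (hd.symm.trans h), fun h ↦ hd.trans (add_eq_left.2 h)⟩

end LeviCivita

section Submanifold

variable {F : Type*} [NormedAddCommGroup F] [NormedSpace ℝ F] [FiniteDimensional ℝ F]
  {N : Type*} [TopologicalSpace N] [ChartedSpace F N] [IsManifold 𝓘(ℝ, F) ∞ N]
  {E : Type*} [NormedAddCommGroup E] [NormedSpace ℝ E] [FiniteDimensional ℝ E]
  {M : Type*} [TopologicalSpace M] [ChartedSpace E M] [IsManifold 𝓘(ℝ, E) ∞ M]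
  {g : SmoothMetric F N} {J : EndoField F N} {η : (q : N) → TangentSpace 𝓘(ℝ, F) q →L[ℝ] ℝ}
  {i : M → N} {D : TangentDistribution E M} {p : M}

/-- The Gauss formula for the Levi-Civita connection of the induced metric. -/
lemma IsSubmanifold.induced_covDeriv (hi : IsSubmanifold E F i) (g : SmoothMetric F N)
    (T : VField E M) (u v : E) :
    inducedMetric (E := E) g i p (covDeriv (inducedMetric (E := E) g i) T p u) v =
      coordForm (fun q ↦ g.inner q) (i p)
        (writtenInExtChartAt 𝓘(ℝ, E) 𝓘(ℝ, F) p i (extChartAt 𝓘(ℝ, E) p p))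
        (fderiv ℝ (writtenInExtChartAt 𝓘(ℝ, E) 𝓘(ℝ, F) p i) (extChartAt 𝓘(ℝ, E) p p)
          (fderiv ℝ (coordField p T) (extChartAt 𝓘(ℝ, E) p p) u) +
          hessianAlong (coordForm (fun q ↦ g.inner q) (i p))
            (writtenInExtChartAt 𝓘(ℝ, E) 𝓘(ℝ, F) p i) (extChartAt 𝓘(ℝ, E) p p) u
            (coordField p T (extChartAt 𝓘(ℝ, E) p p)))
        (fderiv ℝ (writtenInExtChartAt 𝓘(ℝ, E) 𝓘(ℝ, F) p i) (extChartAt 𝓘(ℝ, E) p p) v) := by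
  have hH := (hi.isSmoothMetricForm (E := E) g).isMetricAt p
  have hG : IsMetricAt (coordForm (fun q ↦ g.inner q) (i p))
      (writtenInExtChartAt 𝓘(ℝ, E) 𝓘(ℝ, F) p i (extChartAt 𝓘(ℝ, E) p p)) := by
    rw [writtenInExtChartAt_self]; exact g.isSmoothMetricForm.isMetricAt (i p)
  have hev := eventually_coordForm_induced (p := p) g hi.1
  refine (coordForm_self (inducedMetric (E := E) g i) _ v).symm.trans ?_
  change coordForm (inducedMetric (E := E) g i) p (extChartAt 𝓘(ℝ, E) p p)
    (fderiv ℝ (coordField p T) (extChartAt 𝓘(ℝ, E) p p) u +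
      flatChristoffel (coordForm (inducedMetric (E := E) g i) p) (extChartAt 𝓘(ℝ, E) p p) u
        (coordField p T (extChartAt 𝓘(ℝ, E) p p))) v = _
  rw [map_add, add_apply, map_add, add_apply,
    hG.induced_flatChristoffel (contDiffAt_writtenInExtChartAt hi.1) hH hev,
    hev.self_of_nhds]

/-- For a section `T` of `D^⊥`, the Lie derivative of the induced metric along `T` on vectors of `D`
is, up to sign, the component along `J T` of the second fundamental form. -/
lemma IsCRSubmanifold.symm_covDeriv (hN : IsLCKWithLeeForm g J η) (hM : IsCRSubmanifold g J i D)
    (hB : leeField g η (i p) ∈ normalSpace E g i p) {U : Set M} (hU : IsOpen U) (hp : p ∈ U)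
    {T : VField E M} (hT : IsSectionOn (perpDistribution g i D) T U)
    {u v Ju Jv : TangentSpace 𝓘(ℝ, E) p} (hu : u ∈ D p) (hv : v ∈ D p)
    (hJu : diffAt E F i p Ju = J (i p) (diffAt E F i p u))
    (hJv : diffAt E F i p Jv = J (i p) (diffAt E F i p v)) :
    inducedMetric g i p (covDeriv (inducedMetric g i) T p u) v +
      inducedMetric g i p (covDeriv (inducedMetric g i) T p v) u =
    -g.inner (i p) (J (i p) (diffAt E F i p (T p)))
      (coordHessian g i p u Jv + coordHessian g i p v Ju) := by
  have hL := hN.isLCKAt_written (E := E) i p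
  have hd (u : E) := diffAt_eq_fderiv (p := p) hM.submanifold.1 u
  have hperp {v : E} (hv : v ∈ D p) :
      g.inner (i p) (diffAt E F i p v) (diffAt E F i p (T p)) = 0 :=
    (g.symm (i p) _ _).trans (hT.2 p hp v hv)
  have := hL.symm_covDeriv_totallyReal (contDiffAt_writtenInExtChartAt hM.submanifold.1)
    (hM.isTotallyRealAt hU hp hT) (u := u) (v := v) (Ju := Ju) (Jv := Jv)
    (fun v ↦ by rw [← hd v]; exact (coordForm_written (E := E) g _ _).trans (hB _ ⟨v, rfl⟩))
    (by rw [coordEndo_written, ← hd u, ← hd Ju]; exact hJu)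
    (by rw [coordEndo_written, ← hd v, ← hd Jv]; exact hJv)
    (by rw [coordForm_written, coordField_self, ← hd u, ← hd (T p)]; exact hperp hu)
    (by rw [coordForm_written, coordField_self, ← hd v, ← hd (T p)]; exact hperp hv)
  refine (congrArg₂ (· + ·) (hM.submanifold.induced_covDeriv g T u v)
    (hM.submanifold.induced_covDeriv g T v u)).trans (this.trans ?_)
  rw [coordForm_written, coordEndo_written, coordField_self, ← hd (T p)]
  rfl

/-- As `μ = 0`, normal vectors are determined by their products with `J D^⊥`. -/
lemma IsCRSubmanifold.secondFundamentalForm_add_eq_zero_iff (hM : IsCRSubmanifold g J i D)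
    (hanti : IsAntiHolomorphic g J i D) (u v u' v' : TangentSpace 𝓘(ℝ, E) p) :
    secondFundamentalForm g i p u v + secondFundamentalForm g i p u' v' = 0 ↔
      ∀ t ∈ perpDistribution g i D p, g.inner (i p) (J (i p) (diffAt E F i p t))
        (coordHessian g i p u v + coordHessian g i p u' v') = 0 := by
  have hb := g.isInnerForm (i p)
  rw [secondFundamentalForm_eq hM.submanifold, secondFundamentalForm_eq hM.submanifold,
    ← hb.orthProj_add]
  set a := coordHessian g i p u v + coordHessian g i p u' v'
  constructor
  · intro h t ht
    rw [hb.symm, ← hb.orthProj_apply _ a (hM.endo_mem_normalSpace ht), h, map_zero, zero_apply]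
  · intro h
    have hmem : orthProj (g.inner (i p)) (normalSpace E g i p) a ∈ muSpace g J i D p := by
      refine ⟨IsInnerForm.orthProj_mem _ _, ?_⟩
      rintro _ ⟨_, ⟨t, ht, rfl⟩, rfl⟩
      have hn := hM.endo_mem_normalSpace ht
      exact (hb.orthProj_apply _ a hn).trans ((hb.symm _ _).trans (h t ht))
    rw [hanti p] at hmem
    exact (Submodule.mem_bot ℝ).1 hmem

lemma IsCRSubmanifold.transversal_foliation (hN : IsLCKWithLeeForm g J η)
    (hM : IsCRSubmanifold g J i D) : (hM.foliation hN).transversal (inducedMetric g i) = D :=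
  funext fun p ↦ ((hM.submanifold.isSmoothMetricForm g).inner p).orthCompl_orthCompl (D p)

lemma IsSectionOn.mono {D : TangentDistribution E M} {X : VField E M} {U V : Set M}
    (h : IsSectionOn D X U) (hV : V ⊆ U) : IsSectionOn D X V :=
  ⟨ContMDiffOn.mono h.1 hV, fun p hp ↦ h.2 p (hV hp)⟩

/-- Both conditions say that `g(J T, h(Y, J Z) + h(Z, J Y)) = 0` for all `T` in `D^⊥` and `Y`, `Z`
in `D`. In one direction vectors are extended to local sections; in the other `T` is the component
of the differentiating field along the leaves. -/
lemma IsCRSubmanifold.isBundleLike_iff (hN : IsLCKWithLeeForm g J η)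
    (hM : IsCRSubmanifold g J i D) (hanti : IsAntiHolomorphic g J i D)
    (hB : ∀ p : M, leeField g η (i p) ∈ normalSpace E g i p) :
    IsBundleLike (inducedMetric g i) (hM.foliation hN) ↔
        ∀ (p : M) (u v Ju Jv : TangentSpace 𝓘(ℝ, E) p), u ∈ D p → v ∈ D p →
          diffAt E F i p Ju = J (i p) (diffAt E F i p u) →
          diffAt E F i p Jv = J (i p) (diffAt E F i p v) →
          secondFundamentalForm g i p u Jv + secondFundamentalForm g i p v Ju = 0 := by
  have hg := hM.submanifold.isSmoothMetricForm (E := E) g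
  have hD := hM.transversal_foliation hN
  set 𝓕 := hM.foliation hN
  have hperp := hM.smooth.orthCompl hg
  constructor
  · intro h p u v Ju Jv hu hv hJu hJv
    refine (hM.secondFundamentalForm_add_eq_zero_iff hanti _ _ _ _).2 fun t ht ↦ ?_
    obtain ⟨U₁, Y, hU₁, hp₁, hY, rfl⟩ := hM.smooth.exists_section hu
    obtain ⟨U₂, Z, hU₂, hp₂, hZ, rfl⟩ := hM.smooth.exists_section hv
    obtain ⟨U₃, X, hU₃, hp₃, hX, rfl⟩ := hperp.exists_section ht
    have hU := (hU₁.inter hU₂).inter hU₃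
    set U := (U₁ ∩ U₂) ∩ U₃
    have hpU : p ∈ U := ⟨⟨hp₁, hp₂⟩, hp₃⟩
    have hY' : IsSectionOn (𝓕.transversal (inducedMetric g i)) Y U := by
      rw [hD]; exact hY.mono fun q hq ↦ hq.1.1
    have hZ' : IsSectionOn (𝓕.transversal (inducedMetric g i)) Z U := by
      rw [hD]; exact hZ.mono fun q hq ↦ hq.1.2
    have hX' : IsSectionOn (perpDistribution g i D) X U := hX.mono fun q hq ↦ hq.2
    have hT {q : M} (hq : q ∈ U) : 𝓕.tangentPart (inducedMetric g i) X q = X q :=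
      (hg.inner q).orthProj_of_mem (hX'.2 q hq)
    have hT' : IsSectionOn (perpDistribution g i D) (𝓕.tangentPart (inducedMetric g i) X) U :=
      ⟨hperp.smoothFieldOn_orthProj hg hU hX'.1, fun q hq ↦ IsInnerForm.orthProj_mem _ _⟩
    have e1 := h U X Y Z hU hX'.1 hY' hZ' p hpU
    rw [𝓕.intrinsicConnection_parallel_iff hg hU hpU hY' hZ',
      hM.symm_covDeriv hN (hB p) hU hpU hT' hu hv hJu hJv, hT hpU] at e1
    exact neg_eq_zero.1 e1
  · intro h U X Y Z hU hX hY hZ p hp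
    have hY₀ : Y p ∈ D p := hD ▸ hY.2 p hp
    have hZ₀ : Z p ∈ D p := hD ▸ hZ.2 p hp
    have hT : IsSectionOn (perpDistribution g i D) (𝓕.tangentPart (inducedMetric g i) X) U :=
      ⟨hperp.smoothFieldOn_orthProj hg hU hX, fun q hq ↦ IsInnerForm.orthProj_mem _ _⟩
    obtain ⟨Ju, -, hJu⟩ := hM.exists_diffAt_eq hY₀
    obtain ⟨Jv, -, hJv⟩ := hM.exists_diffAt_eq hZ₀
    have e1 := (hM.secondFundamentalForm_add_eq_zero_iff hanti _ _ _ _).1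
      (h p _ _ Ju Jv hY₀ hZ₀ hJu hJv) _ (hT.2 p hp)
    rw [𝓕.intrinsicConnection_parallel_iff hg hU hp hY hZ,
      hM.symm_covDeriv hN (hB p) hU hp hT hY₀ hZ₀ hJu hJv]
    exact neg_eq_zero.2 e1

end Submanifold

theorem mainTheorem8
    {F : Type*} [NormedAddCommGroup F] [NormedSpace ℝ F] [FiniteDimensional ℝ F]
    {N : Type*} [TopologicalSpace N] [ChartedSpace F N] [IsManifold 𝓘(ℝ, F) ∞ N]
    {E : Type*} [NormedAddCommGroup E] [NormedSpace ℝ E] [FiniteDimensional ℝ E]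
    {M : Type*} [TopologicalSpace M] [ChartedSpace E M] [IsManifold 𝓘(ℝ, E) ∞ M]
    (g : SmoothMetric F N) (J : EndoField F N)
    (η : (q : N) → TangentSpace 𝓘(ℝ, F) q →L[ℝ] ℝ)
    (hN : IsLCKWithLeeForm g J η)
    (i : M → N) (D : TangentDistribution E M)
    (hM : IsCRSubmanifold g J i D)
    (hanti : IsAntiHolomorphic g J i D)
    (hB : ∀ p : M, leeField g η (i p) ∈ normalSpace E g i p) :
    ∃ 𝓕 : Foliation E M, 𝓕.tangent = perpDistribution g i D ∧
      (IsBundleLike (inducedMetric g i) 𝓕 ↔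
        ∀ (p : M) (u v Ju Jv : TangentSpace 𝓘(ℝ, E) p), u ∈ D p → v ∈ D p →
          diffAt E F i p Ju = J (i p) (diffAt E F i p u) →
          diffAt E F i p Jv = J (i p) (diffAt E F i p v) →
          secondFundamentalForm g i p u Jv + secondFundamentalForm g i p v Ju = 0) :=
  ⟨hM.foliation hN, rfl, hM.isBundleLike_iff hN hanti hB⟩
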